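/- Let $M$ be a smooth manifold with a generalized Kähler (GK) structure, given by its biHermitian data $(g,J_+,J_-)$: $g$ is a Riemannian metric, $J_\pm$ are integrable complex structures with $g(J_\pm X,J_\pm Y)=g(X,Y)$, and with $\omega_\pm=gJ_\pm$ (that is, $\omega_\pm(X,Y)=g(J_\pm X,Y)$) and $d^c_\pm=[d,J_\pm^*]$ (where $J_\pm^*$ acts on forms as a derivation) $$d^c_+\omega_++d^c_-\omega_-=0,\qquad dd^c_+\omega_+=0 .$$ Put $H=-d^c_+\omega_+$, let $\nabla$ be the Levi-Civita connection of $g$, and let $\nabla^\pm_XY=\nabla_XY\pm\tfrac12 g^{-1}H(X,Y)$ be the Bismut connections, with curvatures $R^\pm(X,Y)Z=\nabla^\pm_X\nabla^\pm_YZ-\nabla^\pm_Y\nabla^\pm_XZ-\nabla^\pm_{[X,Y]}Z$ and $R^\pm(X,Y,Z,W)=g(R^\pm(X,Y)Z,W)$. Then for all smooth vector fields $X,Y,Z,W$ on $M$ $$R^+(J_-X,J_-Y,Z,W)=R^+(X,Y,Z,W),\qquad R^-(J_+X,J_+Y,Z,W)=R^-(X,Y,Z,W).$$ Moreover, let $T^{1,0}_\pm\subset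 TM\otimes\mathbb C$ be the $\sqrt{-1}$-eigenbundle of $J_\pm$, let $h_\pm(Z,W)=g(Z,\overline W)$ (with $g$ extended complex bilinearly) on $T^{1,0}_\pm$, and extend $\nabla^\pm$ complex linearly to $TM\otimes\mathbb C$. Then $h_\pm$ is a Hermitian metric, $\nabla^\pm$ restricts to a connection on $T^{1,0}_\pm$, and: 1. the $(0,1)$-part $\bar\delta_\pm$ of $\nabla^\pm$ with respect to $J_\mp$ is a $J_\mp$-holomorphic structure on $T^{1,0}_\pm$, i.e. a $\bar\partial$-operator (it maps sections of $T^{1,0}_\pm$ to $T^{1,0}_\pm$-valued $(0,1)$-forms for $J_\mp$ and satisfies $\bar\delta_\pm(fs)=\bar\partial f\otimes s+f\,\bar\delta_\pm s$) with $\bar\delta_\pm^2=0$; 2. $\nabla^\pm$ is the Chern connection of $(T^{1,0}_\pm,\bar\delta_\pm,h_\pm)$ over $(M,J_\mp)$, i.e. the unique connection on $T^{1,0}_\pm$ that preserves $h_\pm$ and whose $(0,1)$-part with respect to $J_\mp$ is $\bar\delta_\pm$. -/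

import Mathlib

open Bundle Manifold VectorField
open scoped ContDiff TensorProduct

noncomputable section

namespace GK

set_option linter.unusedSectionVars false

/-! ### Riemannian metrics and the Levi-Civita connection

`M` is a smooth manifold without boundary, modelled on the finite-dimensional real vector space `E`. -/

variable {E : Type*} [NormedAddCommGroup E] [NormedSpace ℝ E]
  {M : Type*} [TopologicalSpace M] [ChartedSpace E M]

instance tangentSpace_finiteDimensional [FiniteDimensional ℝ E] (x : M) :
    FiniteDimensional ℝ (TangentSpace 𝓘(ℝ, E) x) :=
  inferInstanceAs (FiniteDimensional ℝ E)

instance tangentSpace_t2Space (x : M) : T2Space (TangentSpace 𝓘(ℝ, E) x) :=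
  inferInstanceAs (T2Space E)

/-- Smooth Riemannian metrics on `M`. -/
abbrev Metric (E : Type*) [NormedAddCommGroup E] [NormedSpace ℝ E]
    (M : Type*) [TopologicalSpace M] [ChartedSpace E M] [IsManifold 𝓘(ℝ, E) ∞ M] : Type _ :=
  ContMDiffRiemannianMetric 𝓘(ℝ, E) ∞ E (fun x : M ↦ TangentSpace 𝓘(ℝ, E) x)

variable [IsManifold 𝓘(ℝ, E) ∞ M]

theorem Metric.mdiff (g : Metric E M) {x : M} {X Y : Π x : M, TangentSpace 𝓘(ℝ, E) x}
    (hX : MDiffAt (T% X) x) (hY : MDiffAt (T% Y) x) :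
    MDiffAt (fun y ↦ g.inner y (X y) (Y y)) x := by
  have h := MDifferentiableAt.clm_bundle_apply₂ (𝕜 := ℝ) (F₁ := E) (F₂ := E) (F₃ := ℝ)
    (E₁ := fun x : M ↦ TangentSpace 𝓘(ℝ, E) x) (E₂ := fun x : M ↦ TangentSpace 𝓘(ℝ, E) x)
    (E₃ := Bundle.Trivial M ℝ) (b := fun y => y) (x := x)
    (g.contMDiff.mdifferentiable (by simp) x) hX hY
  rw [mdifferentiableAt_totalSpace] at h
  exact h.2

/-- The right-hand side of the Koszul formula: half of
`X g(Y, Z) + Y g(X, Z) - Z g(X, Y) + g([X, Y], Z) - g([Y, Z], X) - g([X, Z], Y)`. -/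
def koszul (g : Metric E M) (Y : Π x : M, TangentSpace 𝓘(ℝ, E) x) (x : M)
    (X Z : Π x : M, TangentSpace 𝓘(ℝ, E) x) : ℝ :=
  (1 / 2 : ℝ) *
    (d% (fun y ↦ g.inner y (Y y) (Z y)) x (X x)
      + d% (fun y ↦ g.inner y (X y) (Z y)) x (Y x)
      - d% (fun y ↦ g.inner y (X y) (Y y)) x (Z x)
      + g.inner x (mlieBracket 𝓘(ℝ, E) X Y x) (Z x)
      - g.inner x (mlieBracket 𝓘(ℝ, E) Y Z x) (X x)
      - g.inner x (mlieBracket 𝓘(ℝ, E) X Z x) (Y x))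

variable [FiniteDimensional ℝ E]

theorem koszul_tensorial_left (g : Metric E M) {x : M}
    {Y : Π x : M, TangentSpace 𝓘(ℝ, E) x} (hY : MDiffAt (T% Y) x)
    (Z : Π x : M, TangentSpace 𝓘(ℝ, E) x) (hZ : MDiffAt (T% Z) x) :
    TensorialAt 𝓘(ℝ, E) E (koszul g Y x · Z) x where
  smul {f X} hf hX := by
    simp [koszul, mlieBracket_smul_left hf hX, 
      mvfderiv_fun_mul hf (g.mdiff hX hZ), mvfderiv_fun_mul hf (g.mdiff hX hY)]
    ring
  add {X X'} hX hX' := by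
    simp [koszul, mlieBracket_add_left hX hX', 
      mvfderiv_fun_add (g.mdiff hX hZ) (g.mdiff hX' hZ),
      mvfderiv_fun_add (g.mdiff hX hY) (g.mdiff hX' hY)]
    ring

theorem koszul_tensorial_right (g : Metric E M) {x : M}
    {Y : Π x : M, TangentSpace 𝓘(ℝ, E) x} (hY : MDiffAt (T% Y) x)
    (X : Π x : M, TangentSpace 𝓘(ℝ, E) x) (hX : MDiffAt (T% X) x) :
    TensorialAt 𝓘(ℝ, E) E (koszul g Y x X) x where
  smul {f Z} hf hZ := by
    simp [koszul, mlieBracket_smul_right hf hZ, 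
      mvfderiv_fun_mul hf (g.mdiff hX hZ), mvfderiv_fun_mul hf (g.mdiff hY hZ)]
    rw [g.symm x (Z x) (X x), g.symm x (Z x) (Y x)]
    ring
  add {Z Z'} hZ hZ' := by
    simp [koszul, mlieBracket_add_right hZ hZ', 
      mvfderiv_fun_add (g.mdiff hX hZ) (g.mdiff hX hZ'),
      mvfderiv_fun_add (g.mdiff hY hZ) (g.mdiff hY hZ')]
    ring

/-- Lowering an index: the isomorphism `v ↦ g(v, ·)` from `T_x M` onto its dual. -/
def Metric.flat (g : Metric E M) (x : M) :
    TangentSpace 𝓘(ℝ, E) x ≃ₗ[ℝ] (TangentSpace 𝓘(ℝ, E) x →L[ℝ] ℝ) :=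
  LinearMap.linearEquivOfInjective (g.inner x : TangentSpace 𝓘(ℝ, E) x →ₗ[ℝ] _)
    (by
      rw [← LinearMap.ker_eq_bot, LinearMap.ker_eq_bot']
      intro v hv
      by_contra h
      have := g.pos x v h
      have h2 : g.inner x v = 0 := hv
      simp [h2] at this)
    (by
      rw [← (LinearMap.toContinuousLinearMap : (TangentSpace 𝓘(ℝ, E) x →ₗ[ℝ] ℝ) ≃ₗ[ℝ] _).finrank_eq]
      exact (Subspace.dual_finrank_eq (K := ℝ) (V := TangentSpace 𝓘(ℝ, E) x)).symm)

/-- Raising an index: `g⁻¹ : T*_x M → T_x M`. -/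
def Metric.sharp (g : Metric E M) (x : M) :
    (TangentSpace 𝓘(ℝ, E) x →L[ℝ] ℝ) →L[ℝ] TangentSpace 𝓘(ℝ, E) x :=
  LinearMap.toContinuousLinearMap (g.flat x).symm.toLinearMap

theorem Metric.inner_sharp (g : Metric E M) (x : M) (ξ : TangentSpace 𝓘(ℝ, E) x →L[ℝ] ℝ)
    (v : TangentSpace 𝓘(ℝ, E) x) : g.inner x (g.sharp x ξ) v = ξ v := 
  congrArg (fun f : TangentSpace 𝓘(ℝ, E) x →L[ℝ] ℝ => f v) ((g.flat x).apply_symm_apply ξ)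

open Classical in
/-- The vector `∇_X Y` determined by `g(∇_X Y, Z) = koszul g Y x X Z` for all `Z`, as a linear function
of `X` (zero at the points where `Y` is not differentiable). -/
def lcFun (g : Metric E M) (Y : Π x : M, TangentSpace 𝓘(ℝ, E) x) (x : M) :
    TangentSpace 𝓘(ℝ, E) x →L[ℝ] TangentSpace 𝓘(ℝ, E) x :=
  if hY : MDiffAt (T% Y) x then
    (g.sharp x).comp (TensorialAt.mkHom₂ (koszul g Y x) x
      (koszul_tensorial_left g hY) (koszul_tensorial_right g hY))
  else 0

theorem inner_lcFun (g : Metric E M) {X Y Z : Π x : M, TangentSpace 𝓘(ℝ, E) x} {x : M}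
    (hX : MDiffAt (T% X) x) (hY : MDiffAt (T% Y) x) (hZ : MDiffAt (T% Z) x) :
    g.inner x (lcFun g Y x (X x)) (Z x) = koszul g Y x X Z := by
  rw [lcFun, dif_pos hY, ContinuousLinearMap.comp_apply, Metric.inner_sharp,
    TensorialAt.mkHom₂_apply _ _ hX hZ]

theorem Metric.ext_of_fields (g : Metric E M) {x : M} 
    {A B : TangentSpace 𝓘(ℝ, E) x →L[ℝ] TangentSpace 𝓘(ℝ, E) x}
    (h : ∀ X Z : Π x : M, TangentSpace 𝓘(ℝ, E) x, MDiffAt (T% X) x → MDiffAt (T% Z) x →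
      g.inner x (A (X x)) (Z x) = g.inner x (B (X x)) (Z x)) : A = B := by
  ext v
  apply (g.flat x).injective
  ext w
  have := h (FiberBundle.extend E v) (FiberBundle.extend E w)
    (FiberBundle.mdifferentiableAt_extend ..) (FiberBundle.mdifferentiableAt_extend ..)
  simp only [FiberBundle.extend_apply_self] at this
  exact this

/-- The Levi-Civita connection of `g`. -/
def leviCivita (g : Metric E M) :
    CovariantDerivative 𝓘(ℝ, E) E (fun x : M ↦ TangentSpace 𝓘(ℝ, E) x) where
  toFun := lcFun g
  isCovariantDerivativeOnUniv :=
    { add := by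
        intro Y Y' x hY hY' _
        apply g.ext_of_fields
        intro X Z hX hZ
        have hs : MDiffAt (T% (Y + Y')) x := mdifferentiableAt_add_section hY hY'
        simp only [add_apply, map_add]
        rw [inner_lcFun g hX hY hZ, inner_lcFun g hX hY' hZ, inner_lcFun g hX hs hZ]
        simp [koszul, mlieBracket_add_right hY hY', mlieBracket_add_left hY hY',
          mvfderiv_fun_add (g.mdiff hX hY) (g.mdiff hX hY'),
          mvfderiv_fun_add (g.mdiff hY hZ) (g.mdiff hY' hZ)]
        ring
      leibniz := by
        intro Y f x hY hf _
        apply g.ext_of_fields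
        intro X Z hX hZ
        have hs : MDiffAt (T% (f • Y)) x := hf.smul_section hY
        simp only [add_apply, map_add, smul_apply, map_smul,
          ContinuousLinearMap.smulRight_apply, smul_eq_mul]
        rw [inner_lcFun g hX hY hZ, inner_lcFun g hX hs hZ]
        simp [koszul, mlieBracket_smul_right hf hY, mlieBracket_smul_left hf hY,
          mvfderiv_fun_mul hf (g.mdiff hX hY),
          mvfderiv_fun_mul hf (g.mdiff hY hZ)]
        rw [g.symm x (Y x) (X x)]
        ring }

/-- The Levi-Civita connection is torsion free. -/
theorem leviCivita_torsion (g : Metric E M) : (leviCivita g).torsion = 0 := by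
  rw [CovariantDerivative.torsion_eq_zero_iff]
  intro X Y x hX hY
  apply (g.flat x).injective
  ext w
  have hw : MDiffAt (T% (FiberBundle.extend E w)) x := FiberBundle.mdifferentiableAt_extend ..
  have h1 := inner_lcFun g hX hY hw
  have h2 := inner_lcFun g hY hX hw
  change g.inner x (lcFun g Y x (X x) - lcFun g X x (Y x)) w = g.inner x _ w
  simp only [FiberBundle.extend_apply_self] at h1 h2
  simp [h1, h2, koszul]
  have : (fun y ↦ g.inner y (X y) (Y y)) = fun y ↦ g.inner y (Y y) (X y) := by
    ext y; exact g.symm _ _ _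
  rw [mlieBracket_swap_apply (V := Y) (W := X), this]
  simp
  ring

/-- The Levi-Civita connection preserves `g`. -/
theorem leviCivita_metric (g : Metric E M) {x : M} {X Y Z : Π x : M, TangentSpace 𝓘(ℝ, E) x}
    (hX : MDiffAt (T% X) x) (hY : MDiffAt (T% Y) x) (hZ : MDiffAt (T% Z) x) :
    d% (fun y ↦ g.inner y (Y y) (Z y)) x (X x) =
      g.inner x (leviCivita g Y x (X x)) (Z x) + g.inner x (Y x) (leviCivita g Z x (X x)) := by
  rw [g.symm x (Y x)]
  change _ = g.inner x (lcFun g Y x (X x)) (Z x) + g.inner x (lcFun g Z x (X x)) (Y x)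
  rw [inner_lcFun g hX hY hZ, inner_lcFun g hX hZ hY]
  have (Y Z : Π x : M, TangentSpace 𝓘(ℝ, E) x) :
      (fun y ↦ g.inner y (Y y) (Z y)) = fun y ↦ g.inner y (Z y) (Y y) := by
    ext y; exact g.symm _ _ _
  simp [koszul]
  rw [mlieBracket_swap_apply (V := Z) (W := Y), this Z Y]
  simp
  ring

/-! ### Differential forms -/

/-- Differential `k`-forms on `M` (no regularity imposed). -/
abbrev DForm (E : Type*) [NormedAddCommGroup E] [NormedSpace ℝ E]
    (M : Type*) [TopologicalSpace M] [ChartedSpace E M] (k : ℕ) : Type _ :=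
  Π x : M, TangentSpace 𝓘(ℝ, E) x [⋀^Fin k]→L[ℝ] ℝ

/-- The exterior derivative of a form, computed at `x` in the preferred chart at `x`: pull the form
back by the inverse of the chart, differentiate on `E`, and pull the result back by the chart. -/
def extD {k : ℕ} (α : DForm E M k) : DForm E M (k + 1) := fun x ↦
  ContinuousAlternatingMap.compContinuousLinearMap
    (extDeriv (fun e : E ↦
      (ContinuousAlternatingMap.compContinuousLinearMap (α ((extChartAt 𝓘(ℝ, E) x).symm e))
        (mfderiv 𝓘(ℝ, E) 𝓘(ℝ, E) (extChartAt 𝓘(ℝ, E) x).symm e) : E [⋀^Fin k]→L[ℝ] ℝ))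
      (extChartAt 𝓘(ℝ, E) x x))
    (mfderiv 𝓘(ℝ, E) 𝓘(ℝ, E) (extChartAt 𝓘(ℝ, E) x) x)

theorem jStar_aux {k : ℕ} (x : M) (A : TangentSpace 𝓘(ℝ, E) x →L[ℝ] TangentSpace 𝓘(ℝ, E) x)
    (α : TangentSpace 𝓘(ℝ, E) x [⋀^Fin k]→L[ℝ] ℝ) (v : Fin k → TangentSpace 𝓘(ℝ, E) x) :
    ∑ i, α (Function.update v i (A (v i)))
      = (∑ i, α.toMultilinearMap.compLinearMap
          (Function.update (fun _ ↦ LinearMap.id) i A.toLinearMap)) v := by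
  rw [sum_apply]
  refine Finset.sum_congr rfl fun i _ ↦ ?_
  rw [MultilinearMap.compLinearMap_apply]
  refine congrArg α (funext fun j ↦ ?_)
  by_cases h : j = i
  · subst h
    simp
  · simp [Function.update_of_ne h]

/-- The action of `J*` on forms as a derivation:
`(J*α)(v₁, …, v_k) = ∑ i, α(v₁, …, J v_i, …, v_k)`. -/
def jStar {k : ℕ} (J : Π x : M, TangentSpace 𝓘(ℝ, E) x →L[ℝ] TangentSpace 𝓘(ℝ, E) x)
    (α : DForm E M k) : DForm E M k := fun x ↦
  { toFun := fun v ↦ ∑ i, α x (Function.update v i (J x (v i)))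
    map_update_add' := by
      intro _ v i a b
      simp only [jStar_aux]
      exact MultilinearMap.map_update_add _ v i a b
    map_update_smul' := by
      intro _ v i c a
      simp only [jStar_aux]
      exact MultilinearMap.map_update_smul _ v i c a
    map_eq_zero_of_eq' := by
      intro v i j hv hij
      have h0 : ∀ l, l ≠ i → l ≠ j → α x (Function.update v l (J x (v l))) = 0 := fun l hi hj ↦
        (α x).map_eq_zero_of_eq _
          (by rw [Function.update_of_ne hi.symm, Function.update_of_ne hj.symm, hv]) hij
      have h1 : Function.update v j (J x (v j))
          = (Function.update v i (J x (v i))) ∘ Equiv.swap i j := by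
        funext l
        by_cases hlj : l = j
        · subst hlj
          simp [hv]
        · by_cases hli : l = i
          · subst hli
            simp [Function.update_of_ne hij, Function.update_of_ne hij.symm, hv]
          · simp [Function.update_of_ne hlj, Function.update_of_ne hli,
              Equiv.swap_apply_of_ne_of_ne hli hlj]
      rw [Finset.sum_eq_add i j hij (fun l _ hl ↦ h0 l hl.1 hl.2) (by simp) (by simp), h1]
      exact add_eq_zero_iff_eq_neg'.2 ((α x).map_swap _ hij)
    cont := by
      fun_prop }

/-- The operator `d^c = [d, J*]` on forms. -/
def dc {k : ℕ} (J : Π x : M, TangentSpace 𝓘(ℝ, E) x →L[ℝ] TangentSpace 𝓘(ℝ, E) x)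
    (α : DForm E M k) : DForm E M (k + 1) :=
  extD (jStar J α) - jStar J (extD α)

/-- For a `3`-form `H`, the bilinear map `(X, Y) ↦ H(X, Y, ·)` with values in `T*_x M`. -/
def contract (H : DForm E M 3) (x : M) :
    TangentSpace 𝓘(ℝ, E) x →ₗ[ℝ] TangentSpace 𝓘(ℝ, E) x →ₗ[ℝ] (TangentSpace 𝓘(ℝ, E) x →L[ℝ] ℝ) :=
  have u0 (X Y Z a : TangentSpace 𝓘(ℝ, E) x) : Function.update ![X, Y, Z] 0 a = ![a, Y, Z] := by
    funext i; fin_cases i <;> rfl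
  have u1 (X Y Z a : TangentSpace 𝓘(ℝ, E) x) : Function.update ![X, Y, Z] 1 a = ![X, a, Z] := by
    funext i; fin_cases i <;> rfl
  have u2 (X Y Z a : TangentSpace 𝓘(ℝ, E) x) : Function.update ![X, Y, Z] 2 a = ![X, Y, a] := by
    funext i; fin_cases i <;> rfl
  LinearMap.mk₂ ℝ
    (fun X Y ↦ LinearMap.toContinuousLinearMap
      { toFun := fun Z ↦ H x ![X, Y, Z]
        map_add' := fun a b ↦ by
          have h := (H x).map_update_add ![X, Y, 0] 2 a b
          simp only [u2] at h
          exact h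
        map_smul' := fun c a ↦ by
          have h := (H x).map_update_smul ![X, Y, 0] 2 c a
          simp only [u2] at h
          exact h })
    (fun a b Y ↦ by
      ext Z
      have h := (H x).map_update_add ![0, Y, Z] 0 a b
      simp only [u0] at h
      exact h)
    (fun c a Y ↦ by
      ext Z
      have h := (H x).map_update_smul ![0, Y, Z] 0 c a
      simp only [u0] at h
      exact h)
    (fun X a b ↦ by
      ext Z
      have h := (H x).map_update_add ![X, 0, Z] 1 a b
      simp only [u1] at h
      exact h)
    (fun c X a ↦ by
      ext Z
      have h := (H x).map_update_smul ![X, 0, Z] 1 c a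
      simp only [u1] at h
      exact h)

theorem contract_apply (H : DForm E M 3) (x : M) (X Y Z : TangentSpace 𝓘(ℝ, E) x) :
    contract H x X Y Z = H x ![X, Y, Z] := rfl

/-! ### Generalized Kähler structures -/

/-- An integrable complex structure `J` on `M` for which `g` is Hermitian. Integrability is the
vanishing of the Nijenhuis tensor, equivalently the involutivity of the `±i`-eigenbundles of `J`. -/
structure HermitianStructure (g : Metric E M) where
  /-- the complex structure, an endomorphism of the tangent bundle -/
  J : Π x : M, TangentSpace 𝓘(ℝ, E) x →L[ℝ] TangentSpace 𝓘(ℝ, E) x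
  smooth : ContMDiff 𝓘(ℝ, E) (𝓘(ℝ, E).prod 𝓘(ℝ, E →L[ℝ] E)) ∞
    (fun x : M ↦ TotalSpace.mk' (E →L[ℝ] E)
      (E := fun x : M ↦ TangentSpace 𝓘(ℝ, E) x →L[ℝ] TangentSpace 𝓘(ℝ, E) x) x (J x))
  sq : ∀ (x : M) (v : TangentSpace 𝓘(ℝ, E) x), J x (J x v) = -v
  integrable : ∀ X Y : Π x : M, TangentSpace 𝓘(ℝ, E) x, CMDiff ∞ (T% X) → CMDiff ∞ (T% Y) → ∀ x : M,
    mlieBracket 𝓘(ℝ, E) (fun y ↦ J y (X y)) (fun y ↦ J y (Y y)) x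
      - J x (mlieBracket 𝓘(ℝ, E) (fun y ↦ J y (X y)) Y x)
      - J x (mlieBracket 𝓘(ℝ, E) X (fun y ↦ J y (Y y)) x)
      - mlieBracket 𝓘(ℝ, E) X Y x = 0
  hermitian : ∀ (x : M) (v w : TangentSpace 𝓘(ℝ, E) x), g.inner x (J x v) (J x w) = g.inner x v w

/-- The fundamental form `ω = gJ`, that is `ω(v, w) = g(Jv, w)`. -/
def HermitianStructure.omega {g : Metric E M} (S : HermitianStructure g) : DForm E M 2 := fun x ↦
  { toFun := fun v ↦ g.inner x (S.J x (v 0)) (v 1)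
    map_update_add' := by
      intro _ v i a b
      fin_cases i <;> simp
    map_update_smul' := by
      intro _ v i c a
      fin_cases i <;> simp
    map_eq_zero_of_eq' := by
      intro v i j hv hij
      have h01 : v 0 = v 1 := by
        fin_cases i <;> fin_cases j <;> simp_all
      rw [h01]
      have h := S.hermitian x (S.J x (v 1)) (v 1)
      rw [S.sq, g.symm x (S.J x (v 1)), map_neg, neg_apply, g.symm x (v 1)] at h
      linarith
    cont := by
      fun_prop }

variable (E M) in
/-- A generalized Kähler structure on `M`, in terms of its biHermitian data: a Riemannian metric `g`
and two complex structures `J₊`, `J₋`, both compatible with `g`, such that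
`d^c₊ω₊ + d^c₋ω₋ = 0` and `d d^c₊ω₊ = 0`. -/
structure GKStructure where
  /-- the metric -/
  g : Metric E M
  /-- the complex structure `J₊` -/
  plus : HermitianStructure g
  /-- the complex structure `J₋` -/
  minus : HermitianStructure g
  dc_add : dc plus.J plus.omega + dc minus.J minus.omega = 0
  ddc : extD (dc plus.J plus.omega) = 0

namespace GKStructure

variable (𝒢 : GKStructure E M)

/-- The complex structure `J₊`. -/
abbrev Jp : Π x : M, TangentSpace 𝓘(ℝ, E) x →L[ℝ] TangentSpace 𝓘(ℝ, E) x := 𝒢.plus.J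

/-- The complex structure `J₋`. -/
abbrev Jm : Π x : M, TangentSpace 𝓘(ℝ, E) x →L[ℝ] TangentSpace 𝓘(ℝ, E) x := 𝒢.minus.J

/-- The `3`-form `H = -d^c₊ω₊`. -/
def H : DForm E M 3 := -dc 𝒢.Jp 𝒢.plus.omega

/-- The tensor `(Y, X) ↦ ε • g⁻¹H(X, Y)`. -/
def torsionTerm (ε : ℝ) (x : M) :
    TangentSpace 𝓘(ℝ, E) x →L[ℝ] TangentSpace 𝓘(ℝ, E) x →L[ℝ] TangentSpace 𝓘(ℝ, E) x :=
  ε • LinearMap.toContinuousBilinearMap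
    (LinearMap.mk₂ ℝ (fun Y X ↦ 𝒢.g.sharp x (contract 𝒢.H x X Y))
      (by simp) (by simp) (by simp) (by simp))

/-- The Bismut connection `∇⁺_X Y = ∇_X Y + ½ g⁻¹H(X, Y)`, with `∇` the Levi-Civita connection. -/
def nablaPlus : CovariantDerivative 𝓘(ℝ, E) E (fun x : M ↦ TangentSpace 𝓘(ℝ, E) x) :=
  (leviCivita 𝒢.g).addOneForm (𝒢.torsionTerm (1 / 2))

/-- The Bismut connection `∇⁻_X Y = ∇_X Y - ½ g⁻¹H(X, Y)`, with `∇` the Levi-Civita connection. -/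
def nablaMinus : CovariantDerivative 𝓘(ℝ, E) E (fun x : M ↦ TangentSpace 𝓘(ℝ, E) x) :=
  (leviCivita 𝒢.g).addOneForm (𝒢.torsionTerm (-(1 / 2)))

theorem nablaMinus_apply (Y : Π x : M, TangentSpace 𝓘(ℝ, E) x) (x : M)
    (v : TangentSpace 𝓘(ℝ, E) x) :
    𝒢.nablaMinus Y x v =
      leviCivita 𝒢.g Y x v + (-(1 / 2) : ℝ) • 𝒢.g.sharp x (contract 𝒢.H x v (Y x)) := rfl

theorem nablaPlus_apply (Y : Π x : M, TangentSpace 𝓘(ℝ, E) x) (x : M) (v : TangentSpace 𝓘(ℝ, E) x) :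
    𝒢.nablaPlus Y x v =
      leviCivita 𝒢.g Y x v + (1 / 2 : ℝ) • 𝒢.g.sharp x (contract 𝒢.H x v (Y x)) := rfl

end GKStructure

/-- The curvature `R(X, Y)Z = ∇_X∇_Y Z - ∇_Y∇_X Z - ∇_{[X, Y]}Z` of a connection on `TM`. -/
def curvature (D : CovariantDerivative 𝓘(ℝ, E) E (fun x : M ↦ TangentSpace 𝓘(ℝ, E) x))
    (X Y Z : Π x : M, TangentSpace 𝓘(ℝ, E) x) (x : M) : TangentSpace 𝓘(ℝ, E) x :=
  D (fun y ↦ D Z y (Y y)) x (X x) - D (fun y ↦ D Z y (X y)) x (Y x)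
    - D Z x (mlieBracket 𝓘(ℝ, E) X Y x)

/-- The covariant curvature tensor `R(X, Y, Z, W) = g(R(X, Y)Z, W)`, as a function on `M`. -/
def curvature4 (g : Metric E M)
    (D : CovariantDerivative 𝓘(ℝ, E) E (fun x : M ↦ TangentSpace 𝓘(ℝ, E) x))
    (X Y Z W : Π x : M, TangentSpace 𝓘(ℝ, E) x) (x : M) : ℝ :=
  g.inner x (curvature D X Y Z x) (W x)

/-! ### The complexified tangent bundle -/

variable (E) in
/-- The complexified tangent space `T_x M ⊗ ℂ`. -/
abbrev CTan (x : M) : Type _ := ℂ ⊗[ℝ] TangentSpace 𝓘(ℝ, E) x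

/-- The real part `T_x M ⊗ ℂ → T_x M`. -/
def reC (x : M) : CTan E x →ₗ[ℝ] TangentSpace 𝓘(ℝ, E) x :=
  (TensorProduct.lid ℝ (TangentSpace 𝓘(ℝ, E) x)).toLinearMap ∘ₗ
    LinearMap.rTensor (TangentSpace 𝓘(ℝ, E) x) Complex.reLm

/-- The imaginary part `T_x M ⊗ ℂ → T_x M`. -/
def imC (x : M) : CTan E x →ₗ[ℝ] TangentSpace 𝓘(ℝ, E) x :=
  (TensorProduct.lid ℝ (TangentSpace 𝓘(ℝ, E) x)).toLinearMap ∘ₗ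
    LinearMap.rTensor (TangentSpace 𝓘(ℝ, E) x) Complex.imLm

/-- The complex vector `v + i w`. -/
def mkC {x : M} (v w : TangentSpace 𝓘(ℝ, E) x) : CTan E x :=
  (1 : ℂ) ⊗ₜ[ℝ] v + Complex.I ⊗ₜ[ℝ] w

theorem reC_mkC {x : M} (v w : TangentSpace 𝓘(ℝ, E) x) : reC x (mkC v w) = v := by
  simp [reC, mkC]

theorem imC_mkC {x : M} (v w : TangentSpace 𝓘(ℝ, E) x) : imC x (mkC v w) = w := by
  simp [imC, mkC]

/-- Smoothness of a complex vector field. -/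
def IsSmooth (Z : Π x : M, CTan E x) : Prop :=
  CMDiff ∞ (T% (fun x : M ↦ reC x (Z x))) ∧ CMDiff ∞ (T% (fun x : M ↦ imC x (Z x)))

/-- `T^{1,0}` of an almost complex structure: the `i`-eigenbundle of `J` in `TM ⊗ ℂ`. -/
def T10 (J : Π x : M, TangentSpace 𝓘(ℝ, E) x →L[ℝ] TangentSpace 𝓘(ℝ, E) x) (x : M) :
    Submodule ℂ (CTan E x) :=
  Module.End.eigenspace (LinearMap.baseChange ℂ (J x : _ →ₗ[ℝ] _)) Complex.I

/-- `T^{0,1}` of an almost complex structure: the `-i`-eigenbundle of `J` in `TM ⊗ ℂ`. -/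
def T01 (J : Π x : M, TangentSpace 𝓘(ℝ, E) x →L[ℝ] TangentSpace 𝓘(ℝ, E) x) (x : M) :
    Submodule ℂ (CTan E x) :=
  Module.End.eigenspace (LinearMap.baseChange ℂ (J x : _ →ₗ[ℝ] _)) (-Complex.I)

/-- The projection `w ↦ ½ (w + i J w)` of `TM ⊗ ℂ = T^{1,0} ⊕ T^{0,1}` onto `T^{0,1}`. -/
def proj01 (J : Π x : M, TangentSpace 𝓘(ℝ, E) x →L[ℝ] TangentSpace 𝓘(ℝ, E) x) (x : M) :
    CTan E x →ₗ[ℂ] CTan E x :=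
  (1 / 2 : ℂ) • (LinearMap.id + Complex.I • LinearMap.baseChange ℂ (J x : _ →ₗ[ℝ] _))

/-- The complex bilinear extension of the Lie bracket to complex vector fields. -/
def cBracket (Z W : Π x : M, CTan E x) (x : M) : CTan E x :=
  mkC
    (mlieBracket 𝓘(ℝ, E) (fun y ↦ reC y (Z y)) (fun y ↦ reC y (W y)) x
      - mlieBracket 𝓘(ℝ, E) (fun y ↦ imC y (Z y)) (fun y ↦ imC y (W y)) x)
    (mlieBracket 𝓘(ℝ, E) (fun y ↦ reC y (Z y)) (fun y ↦ imC y (W y)) x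
      + mlieBracket 𝓘(ℝ, E) (fun y ↦ imC y (Z y)) (fun y ↦ reC y (W y)) x)

/-- The complex linear extension of the differential of a complex function, `w ↦ df(w)`. -/
def dC (f : M → ℂ) (x : M) : CTan E x →ₗ[ℂ] ℂ :=
  LinearMap.liftBaseChange ℂ ((d% f x : TangentSpace 𝓘(ℝ, E) x →L[ℝ] ℂ) : _ →ₗ[ℝ] ℂ)

/-- The complex linear extension of a connection on `TM` to `TM ⊗ ℂ`. The value on a complex vector
field `s` at a complex tangent vector `w` is `complexify D s x w = ∇_w s`. -/
def complexify (D : CovariantDerivative 𝓘(ℝ, E) E (fun x : M ↦ TangentSpace 𝓘(ℝ, E) x))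
    (s : Π x : M, CTan E x) (x : M) : CTan E x →ₗ[ℂ] CTan E x :=
  LinearMap.baseChange ℂ (D (fun y ↦ reC y (s y)) x : _ →ₗ[ℝ] _)
    + Complex.I • LinearMap.baseChange ℂ (D (fun y ↦ imC y (s y)) x : _ →ₗ[ℝ] _)

/-- The sesquilinear form `h(Z, W) = g(Z, W̄)` on `TM ⊗ ℂ`, with `g` extended complex bilinearly: for
`Z = a + i b` and `W = c + i d` it is `g(a, c) + g(b, d) + i (g(b, c) - g(a, d))`. -/
def hermForm (g : Metric E M) (x : M) (Z W : CTan E x) : ℂ :=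
  ⟨g.inner x (reC x Z) (reC x W) + g.inner x (imC x Z) (imC x W),
    g.inner x (imC x Z) (reC x W) - g.inner x (reC x Z) (imC x W)⟩

theorem mem_T10 (J : Π x : M, TangentSpace 𝓘(ℝ, E) x →L[ℝ] TangentSpace 𝓘(ℝ, E) x) (x : M)
    (w : CTan E x) :
    w ∈ T10 J x ↔ LinearMap.baseChange ℂ (J x : _ →ₗ[ℝ] _) w = Complex.I • w :=
  Module.End.mem_eigenspace_iff

/-! ### Connections, holomorphic structures and Chern connections

In this section `V` is a complex subbundle of `TM ⊗ ℂ`. An operator on sections of `V` with values in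
`V`-valued one-forms is written `D s x w`: the value of `D_w s` at the point `x`, for `w ∈ T_x M ⊗ ℂ`. -/

/-- Smooth sections of a subbundle `V` of `TM ⊗ ℂ`. -/
def IsSection (V : Π x : M, Submodule ℂ (CTan E x)) (s : Π x : M, CTan E x) : Prop :=
  IsSmooth s ∧ ∀ x, s x ∈ V x

/-- `D` is a connection on the complex vector bundle `V`. -/
structure IsConnection (V : Π x : M, Submodule ℂ (CTan E x))
    (D : (Π x : M, CTan E x) → Π x : M, CTan E x →ₗ[ℂ] CTan E x) : Prop where
  mem : ∀ s, IsSection V s → ∀ (x : M) (w : CTan E x), D s x w ∈ V x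
  smooth : ∀ s, IsSection V s → ∀ Z : Π x : M, CTan E x, IsSmooth Z → IsSmooth fun x ↦ D s x (Z x)
  add : ∀ s t, IsSection V s → IsSection V t → ∀ x, D (fun y ↦ s y + t y) x = D s x + D t x
  leibniz : ∀ (f : M → ℂ) s, ContMDiff 𝓘(ℝ, E) 𝓘(ℝ, ℂ) ∞ f → IsSection V s → ∀ (x : M) (w : CTan E x),
    D (fun y ↦ f y • s y) x w = dC f x w • s x + f x • D s x w

/-- `δ` is a holomorphic structure on the complex vector bundle `V` over the complex manifold
`(M, J)`: an operator from sections of `V` to `(0,1)`-forms with values in `V` (which vanish on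
`T^{1,0}`) with the Leibniz rule `δ(f s) = ∂̄f ⊗ s + f δs`, whose square
`δ²s(Z, W) = δ_Z δ_W s - δ_W δ_Z s - δ_{[Z, W]} s`, a `(0,2)`-form with values in `V`, is zero. -/
structure IsHolomorphicStructure (J : Π x : M, TangentSpace 𝓘(ℝ, E) x →L[ℝ] TangentSpace 𝓘(ℝ, E) x)
    (V : Π x : M, Submodule ℂ (CTan E x))
    (δ : (Π x : M, CTan E x) → Π x : M, CTan E x →ₗ[ℂ] CTan E x) : Prop where
  mem : ∀ s, IsSection V s → ∀ (x : M) (w : CTan E x), δ s x w ∈ V x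
  type01 : ∀ s, IsSection V s → ∀ (x : M), ∀ w ∈ T10 J x, δ s x w = 0
  smooth : ∀ s, IsSection V s → ∀ Z : Π x : M, CTan E x, IsSmooth Z → IsSmooth fun x ↦ δ s x (Z x)
  add : ∀ s t, IsSection V s → IsSection V t → ∀ x, δ (fun y ↦ s y + t y) x = δ s x + δ t x
  leibniz : ∀ (f : M → ℂ) s, ContMDiff 𝓘(ℝ, E) 𝓘(ℝ, ℂ) ∞ f → IsSection V s → ∀ (x : M) (w : CTan E x),
    δ (fun y ↦ f y • s y) x w = dC f x (proj01 J x w) • s x + f x • δ s x w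
  flat : ∀ s, IsSection V s → ∀ Z W, IsSection (T01 J) Z → IsSection (T01 J) W → ∀ x : M,
    δ (fun y ↦ δ s y (W y)) x (Z x) - δ (fun y ↦ δ s y (Z y)) x (W x) - δ s x (cBracket Z W x) = 0

/-- The `(0,1)`-part, with respect to `J`, of a connection. -/
def dbarPart (J : Π x : M, TangentSpace 𝓘(ℝ, E) x →L[ℝ] TangentSpace 𝓘(ℝ, E) x)
    (D : (Π x : M, CTan E x) → Π x : M, CTan E x →ₗ[ℂ] CTan E x) :
    (Π x : M, CTan E x) → Π x : M, CTan E x →ₗ[ℂ] CTan E x :=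
  fun s x ↦ D s x ∘ₗ proj01 J x

/-- `h` is a (smooth) Hermitian metric on the complex vector bundle `V`. -/
structure IsHermitianMetric (V : Π x : M, Submodule ℂ (CTan E x))
    (h : Π x : M, CTan E x → CTan E x → ℂ) : Prop where
  add_left : ∀ x, ∀ s ∈ V x, ∀ t ∈ V x, ∀ u ∈ V x, h x (s + t) u = h x s u + h x t u
  smul_left : ∀ x (c : ℂ), ∀ s ∈ V x, ∀ t ∈ V x, h x (c • s) t = c * h x s t
  conj_symm : ∀ x, ∀ s ∈ V x, ∀ t ∈ V x, h x t s = starRingEnd ℂ (h x s t)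
  pos : ∀ x, ∀ s ∈ V x, s ≠ 0 → 0 < (h x s s).re
  smooth : ∀ s t, IsSection V s → IsSection V t → ContMDiff 𝓘(ℝ, E) 𝓘(ℝ, ℂ) ∞ (fun x : M ↦ h x (s x) (t x))

/-- `D` is the Chern connection of the holomorphic structure `δ` on the vector bundle `V` over the
complex manifold `(M, J)`, equipped with the Hermitian metric `h`: it is a connection on `V`, it
preserves `h`, and its `(0,1)`-part is `δ`. -/
structure IsChernConnection (J : Π x : M, TangentSpace 𝓘(ℝ, E) x →L[ℝ] TangentSpace 𝓘(ℝ, E) x)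
    (V : Π x : M, Submodule ℂ (CTan E x)) (h : Π x : M, CTan E x → CTan E x → ℂ)
    (δ : (Π x : M, CTan E x) → Π x : M, CTan E x →ₗ[ℂ] CTan E x)
    (D : (Π x : M, CTan E x) → Π x : M, CTan E x →ₗ[ℂ] CTan E x) : Prop where
  isConnection : IsConnection V D
  hermitian : ∀ s t, IsSection V s → IsSection V t → ∀ (x : M) (v : TangentSpace 𝓘(ℝ, E) x),
    d% (fun y : M ↦ h y (s y) (t y)) x v
      = h x (D s x (mkC v 0)) (t x) + h x (s x) (D t x (mkC v 0))
  dbar_eq : ∀ s, IsSection V s → ∀ x, dbarPart J D s x = δ s x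

end GK

end

noncomputable section

namespace GK

set_option linter.unusedSectionVars false

/-! ### Algebra of the Levi-Civita calculus -/

/-! Put B = ½g⁻¹H, so that ∇^± = ∇ ± B are metric connections with totally skew torsion ±H. The key
is the exchange identity R⁺(X,Y,Z,W) = R⁻(Z,W,X,Y). In the difference of the two sides the
Levi-Civita parts cancel by pair symmetry, the terms quadratic in B cancel by skewness, and the
terms linear in B add up to ½dH(X,Y,Z,W), which is zero (`g_curv_bismut_pair_symm`).

On the other hand ∇⁺ is the Bismut connection of (g, J₊), and ∇⁻ is that of (g, J₋) because -d^c₋ω₋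
= -H. Integrability then gives ∇^±J_± = 0 (`bismut_parallel`). Hence R⁻(Z,W) commutes with J₋, so R⁻
is J₋-invariant in its last two arguments, and by the exchange identity R⁺ is J₋-invariant in its
first two: it has type (1,1) for J₋ (`curv_bismut_apply_J`).

The complex statements follow. Since ∇⁺J₊ = 0, ∇⁺ acts on the eigenbundle of J₊. The square of its
(0,1)-part for J₋ is the (0,2)-part of R⁺, which vanishes, and ∇⁺g = 0 makes it Hermitian. Two Chern
connections differ by an operator that kills T^{0,1} and is skew-Hermitian, so it kills T^{1,0} too
(`IsChernConnection.unique`). The statements about ∇⁻ come from exchanging J₊ and J₋, which replaces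
H by -H (`GKStructure.swap`).

The curvature identities are formal consequences of the axioms in `FieldCalculus`, where fields and
functions are mere real vector spaces and no linearity over functions is used. Geometry enters
through `fieldCalculus`, which supplies the axioms, and through `SmoothForm.extD_apply`, which turns
the chart definition of d into the invariant formulas `dTwo` and `dThree`. -/

/-- The algebraic structure on the space `V` of vector fields and the space `C` of functions of a
Riemannian manifold: derivatives of functions, the Lie bracket, the metric and the Levi-Civita
connection. -/
structure FieldCalculus (V C : Type*) [AddCommGroup V] [Module ℝ V] [AddCommGroup C]
    [Module ℝ C] where
  /-- the derivative of a function along a field -/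
  D : V →ₗ[ℝ] C →ₗ[ℝ] C
  /-- the Lie bracket -/
  br : V →ₗ[ℝ] V →ₗ[ℝ] V
  /-- the metric -/
  g : V →ₗ[ℝ] V →ₗ[ℝ] C
  /-- the Levi-Civita connection -/
  nab : V →ₗ[ℝ] V →ₗ[ℝ] V
  D_br : ∀ X Y f, D (br X Y) f = D X (D Y f) - D Y (D X f)
  jacobi : ∀ X Y Z, br X (br Y Z) = br (br X Y) Z + br Y (br X Z)
  g_symm : ∀ X Y, g X Y = g Y X
  g_ext : ∀ X Y, (∀ Z, g X Z = g Y Z) → X = Y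
  torsion : ∀ X Y, br X Y = nab X Y - nab Y X
  metric : ∀ X Y Z, D X (g Y Z) = g (nab X Y) Z + g Y (nab X Z)

namespace FieldCalculus

variable {V C : Type*} [AddCommGroup V] [Module ℝ V] [AddCommGroup C] [Module ℝ C]
  (𝒜 : FieldCalculus V C)

/-- The curvature of a connection. -/
def curv (K : V →ₗ[ℝ] V →ₗ[ℝ] V) (X Y Z : V) : V :=
  K X (K Y Z) - K Y (K X Z) - K (𝒜.br X Y) Z

/-- The exterior derivative of a `2`-form. -/
def dTwo (α : V → V → C) (X Y Z : V) : C :=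
  𝒜.D X (α Y Z) - 𝒜.D Y (α X Z) + 𝒜.D Z (α X Y)
    - α (𝒜.br X Y) Z + α (𝒜.br X Z) Y - α (𝒜.br Y Z) X

/-- The exterior derivative of a `3`-form. -/
def dThree (h : V → V → V → C) (X Y Z W : V) : C :=
  𝒜.D X (h Y Z W) - 𝒜.D Y (h X Z W) + 𝒜.D Z (h X Y W) - 𝒜.D W (h X Y Z)
    - h (𝒜.br X Y) Z W + h (𝒜.br X Z) Y W - h (𝒜.br X W) Y Z
    - h (𝒜.br Y Z) X W + h (𝒜.br Y W) X Z - h (𝒜.br Z W) X Y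

theorem eq_of_two_smul_eq {a b : C} (h : (2 : ℝ) • a = (2 : ℝ) • b) : a = b :=
  smul_right_injective C (two_ne_zero : (2 : ℝ) ≠ 0) h

theorem curv_swap (K : V →ₗ[ℝ] V →ₗ[ℝ] V) (X Y Z : V) :
    𝒜.curv K X Y Z = -𝒜.curv K Y X Z := by
  have : 𝒜.br X Y = -𝒜.br Y X := by rw [𝒜.torsion, 𝒜.torsion]; abel
  simp only [curv, this, map_neg, LinearMap.neg_apply]
  abel

/-- Differentiate g(Z,W) along [X,Y] as a commutator of derivatives: the mixed terms g(K_X Z, K_Y W)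
cancel. -/
theorem g_curv_skew (K : V →ₗ[ℝ] V →ₗ[ℝ] V)
    (hK : ∀ X Y Z, 𝒜.D X (𝒜.g Y Z) = 𝒜.g (K X Y) Z + 𝒜.g Y (K X Z)) (X Y Z W : V) :
    𝒜.g (𝒜.curv K X Y Z) W = -𝒜.g (𝒜.curv K X Y W) Z := by
  have h := 𝒜.D_br X Y (𝒜.g Z W)
  simp only [hK, map_add] at h
  have h1 := 𝒜.g_symm W
  simp only [curv, map_sub, LinearMap.sub_apply]
  rw [𝒜.g_symm (K X (K Y W)) Z, 𝒜.g_symm (K Y (K X W)) Z, 𝒜.g_symm (K (𝒜.br X Y) W) Z]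
  linear_combination (norm := module) -h

/-- This is the Jacobi identity with every bracket written as a difference of covariant derivatives.
-/
theorem first_bianchi (X Y Z : V) :
    𝒜.curv 𝒜.nab X Y Z + 𝒜.curv 𝒜.nab Y Z X + 𝒜.curv 𝒜.nab Z X Y = 0 := by
  have h := 𝒜.jacobi X Y Z
  simp only [𝒜.torsion, map_sub, LinearMap.sub_apply] at h
  simp only [curv, 𝒜.torsion, map_sub, LinearMap.sub_apply]
  linear_combination (norm := module) h

theorem g_curv_pair_symm (X Y Z W : V) :
    𝒜.g (𝒜.curv 𝒜.nab X Y Z) W = 𝒜.g (𝒜.curv 𝒜.nab Z W X) Y := by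
  have s := 𝒜.g_curv_skew 𝒜.nab 𝒜.metric
  have t (X Y Z W : V) : 𝒜.g (𝒜.curv 𝒜.nab X Y Z) W = -𝒜.g (𝒜.curv 𝒜.nab Y X Z) W := by
    rw [𝒜.curv_swap, map_neg, LinearMap.neg_apply]
  have b (X Y Z W : V) : 𝒜.g (𝒜.curv 𝒜.nab X Y Z) W + 𝒜.g (𝒜.curv 𝒜.nab Y Z X) W
      + 𝒜.g (𝒜.curv 𝒜.nab Z X Y) W = 0 := by
    rw [← LinearMap.add_apply, ← LinearMap.add_apply, ← map_add, ← map_add, first_bianchi,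
      map_zero, LinearMap.zero_apply]
  apply eq_of_two_smul_eq
  -- Four cyclic sums, one for each choice of last argument, are brought to common representatives
  -- by the two skew-symmetries. In the signed sum everything cancels except twice the required
  -- difference.
  have b2 := b Y Z W X
  rw [s Y Z W X, s Z W Y X, t W Y] at b2
  have b3 := b Z W X Y
  rw [t W X Z Y, s X W Z Y, t X Z W Y, s Z X W Y] at b3
  have b4 := b W X Y Z
  rw [t W X Y Z, s X Y W Z, s Y W X Z] at b4
  linear_combination (norm := module) b X Y Z W + b2 - b3 - b4

/-- The curvatures of the metric connections `∇ ± B` whose torsion is a closed `3`-form are exchanged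
by the interchange of the two pairs of arguments. -/
theorem g_curv_bismut_pair_symm (h : V → V → V → C) (B : V →ₗ[ℝ] V →ₗ[ℝ] V)
    (hB : ∀ X Y Z, 𝒜.g (B X Y) Z = h X Y Z) (h_swap : ∀ X Y Z, h X Y Z = -h Y X Z)
    (h_swap' : ∀ X Y Z, h X Y Z = -h X Z Y) (hd : ∀ X Y Z W, 𝒜.dThree h X Y Z W = 0)
    (X Y Z W : V) :
    𝒜.g (𝒜.curv (𝒜.nab + B) X Y Z) W = 𝒜.g (𝒜.curv (𝒜.nab - B) Z W X) Y := by
  -- R(∇ + B) is the Levi-Civita curvature plus terms linear and quadratic in B. Metric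
  -- compatibility rewrites g(∇_X(B Y Z), W) through derivatives of h.
  have hP (X Y Z W : V) : 𝒜.g (𝒜.curv (𝒜.nab + B) X Y Z) W = 𝒜.g (𝒜.curv 𝒜.nab X Y Z) W
      + (𝒜.D X (h Y Z W) - h Y Z (𝒜.nab X W) + h X (𝒜.nab Y Z) W)
      - (𝒜.D Y (h X Z W) - h X Z (𝒜.nab Y W) + h Y (𝒜.nab X Z) W)
      - h (𝒜.br X Y) Z W - 𝒜.g (B X W) (B Y Z) + 𝒜.g (B Y W) (B X Z) := by
    have m (X Y Z W : V) :
        𝒜.g (𝒜.nab X (B Y Z)) W = 𝒜.D X (h Y Z W) - h Y Z (𝒜.nab X W) := by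
      rw [← hB, ← hB, 𝒜.metric]; abel
    have q (X Y Z W : V) : 𝒜.g (B X (B Y Z)) W = -𝒜.g (B X W) (B Y Z) := by
      rw [hB, hB, h_swap']
    simp only [curv, map_sub, map_add, LinearMap.sub_apply, LinearMap.add_apply, m, q, hB]
    abel
  -- For ∇ - B the linear terms change sign and the quadratic ones do not.
  have hM (X Y Z W : V) : 𝒜.g (𝒜.curv (𝒜.nab - B) X Y Z) W = 𝒜.g (𝒜.curv 𝒜.nab X Y Z) W
      - (𝒜.D X (h Y Z W) - h Y Z (𝒜.nab X W) + h X (𝒜.nab Y Z) W)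
      + (𝒜.D Y (h X Z W) - h X Z (𝒜.nab Y W) + h Y (𝒜.nab X Z) W)
      + h (𝒜.br X Y) Z W - 𝒜.g (B X W) (B Y Z) + 𝒜.g (B Y W) (B X Z) := by
    have m (X Y Z W : V) :
        𝒜.g (𝒜.nab X (B Y Z)) W = 𝒜.D X (h Y Z W) - h Y Z (𝒜.nab X W) := by
      rw [← hB, ← hB, 𝒜.metric]; abel
    have q (X Y Z W : V) : 𝒜.g (B X (B Y Z)) W = -𝒜.g (B X W) (B Y Z) := by
      rw [hB, hB, h_swap']
    simp only [curv, map_sub, LinearMap.sub_apply, m, q, hB]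
    abel
  have add₁ (X X' Y Z : V) : h (X - X') Y Z = h X Y Z - h X' Y Z := by
    simp only [← hB, map_sub, LinearMap.sub_apply]
  have hBswap (X Y : V) : B X Y = -B Y X :=
    𝒜.g_ext _ _ fun Z ↦ by rw [map_neg, LinearMap.neg_apply, hB, hB, h_swap]
  have e := hd X Y Z W
  rw [dThree] at e
  rw [hP, hM, 𝒜.g_curv_pair_symm]
  simp only [𝒜.torsion, add₁] at e ⊢
  have rot (X Y Z : V) : h X Y Z = h Z X Y := by rw [h_swap' X, h_swap X Z, neg_neg]
  -- All values of h and B are brought to a common order of arguments. The quadratic terms then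
  -- agree, and the linear ones differ by exactly dh.
  rw [rot Y Z (𝒜.nab X W), rot X Z (𝒜.nab Y W), h_swap X (𝒜.nab Y Z), h_swap Y (𝒜.nab X Z),
    rot W X (𝒜.nab Z Y), h_swap' _ W X, rot Z X (𝒜.nab W Y), h_swap' _ Z X,
    h_swap Z (𝒜.nab W X), h_swap' _ Z Y, h_swap W (𝒜.nab Z X), h_swap' _ W Y,
    ← rot X Y W, ← rot X Y Z, hBswap Z Y, hBswap W X, hBswap W Y, hBswap Z X]
  simp only [map_neg, LinearMap.neg_apply, neg_neg, 𝒜.g_symm (B Y Z)]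
  linear_combination (norm := module) e

/-- The connection `∇ + B`, whose torsion is the `3`-form `2h = dω(J·, ·, ·) + dω(·, J·, ·) + dω(·, ·, J·)`,
preserves the integrable complex structure `J`. -/
theorem bismut_parallel (J : V →ₗ[ℝ] V) (hJ : ∀ X, J (J X) = -X)
    (hJg : ∀ X Y, 𝒜.g (J X) (J Y) = 𝒜.g X Y)
    (hN : ∀ X Y, 𝒜.br (J X) (J Y) - J (𝒜.br (J X) Y) - J (𝒜.br X (J Y)) - 𝒜.br X Y = 0)
    (h : V → V → V → C) (B : V →ₗ[ℝ] V →ₗ[ℝ] V) (hB : ∀ X Y Z, 𝒜.g (B X Y) Z = h X Y Z)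
    (hh : ∀ X Y Z, (2 : ℝ) • h X Y Z = 𝒜.dTwo (fun X Y ↦ 𝒜.g (J X) Y) (J X) Y Z
      + 𝒜.dTwo (fun X Y ↦ 𝒜.g (J X) Y) X (J Y) Z + 𝒜.dTwo (fun X Y ↦ 𝒜.g (J X) Y) X Y (J Z))
    (X Y : V) : (𝒜.nab + B) X (J Y) = J ((𝒜.nab + B) X Y) := by
  have hJg' (X Y : V) : 𝒜.g (J X) Y = -𝒜.g X (J Y) := by
    rw [← hJg X (J Y), hJ, map_neg, neg_neg]
  -- P(X,Y,Z) = g((∇_X J)Y, Z) = (∇_X ω)(Y,Z). It is skew in Y, Z and J moves freely between these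
  -- two slots.
  let P (X Y Z : V) : C := 𝒜.g (𝒜.nab X (J Y) - J (𝒜.nab X Y)) Z
  have P_eq (X Y Z : V) : P X Y Z = 𝒜.g (𝒜.nab X (J Y)) Z + 𝒜.g (𝒜.nab X Y) (J Z) := by
    simp only [P, map_sub, LinearMap.sub_apply, hJg']
    abel
  have P_skew (X Y Z : V) : P X Y Z = -P X Z Y := by
    have e1 := 𝒜.metric X (J Y) Z
    have e2 := 𝒜.metric X Y (J Z)
    rw [hJg', map_neg] at e1
    rw [P_eq, P_eq, 𝒜.g_symm (𝒜.nab X (J Z)), 𝒜.g_symm (𝒜.nab X Z)]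
    linear_combination (norm := module) -e1 - e2
  have P_J (X Y Z : V) : P X (J Y) Z = P X Y (J Z) := by
    rw [P_eq, P_eq, hJ, hJ]
    simp only [map_neg, LinearMap.neg_apply]
    abel
  have P_neg (X Y Z : V) : P X Y (-Z) = -P X Y Z := map_neg _ _
  -- Integrability in the form ∇_{JX}J = J∇_X J. The defect A is skew in its last two arguments, and
  -- symmetric in the first two by the vanishing of the Nijenhuis tensor; such a trilinear
  -- expression is zero.
  have P_int (X Y Z : V) : P (J X) Y Z = -P X Y (J Z) := by
    let A (X Y Z : V) : C := P (J X) Y Z + P X Y (J Z)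
    have A_skew (X Y Z : V) : A X Y Z = -A X Z Y := by
      simp only [A]
      rw [P_skew (J X), P_skew X, P_J]
      abel
    have A_symm (X Y Z : V) : A X Y Z = A Y X Z := by
      have e : 𝒜.g _ Z = 𝒜.g _ Z := congrArg (fun U ↦ 𝒜.g U Z) (hN X Y)
      simp only [𝒜.torsion, map_sub, LinearMap.sub_apply, map_zero, LinearMap.zero_apply] at e
      simp only [hJg'] at e
      simp only [A, P_eq, hJ, map_neg]
      linear_combination (norm := module) e
    have : A X Y Z = 0 := by
      have : A X Y Z = -A X Y Z := by
        conv_lhs => rw [A_symm, A_skew, A_symm, A_skew, A_symm, A_skew]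
        simp
      exact eq_of_two_smul_eq (by linear_combination (norm := module) this)
    exact eq_neg_of_add_eq_zero_left this
  -- As ∇ is torsion free, dω is the alternation of ∇ω.
  have d_eq (X Y Z : V) :
      𝒜.dTwo (fun X Y ↦ 𝒜.g (J X) Y) X Y Z = P X Y Z - P Y X Z + P Z X Y := by
    simp only [dTwo, P, 𝒜.metric, 𝒜.torsion, map_sub, LinearMap.sub_apply]
    rw [hJg' (𝒜.nab X Z) Y, hJg' (𝒜.nab Y Z) X, hJg' (𝒜.nab Z Y) X, 𝒜.g_symm (𝒜.nab X Z),
      𝒜.g_symm (𝒜.nab Y Z), 𝒜.g_symm (𝒜.nab Z Y)]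
    abel
  have h_eq (X Y Z : V) : (2 : ℝ) • h X Y Z = P X Y (J Z) - P Y X (J Z) + P Z X (J Y) := by
    rw [hh, d_eq, d_eq, d_eq, P_int, P_int, P_int, P_J, P_J, P_J]
    abel
  refine 𝒜.g_ext _ _ fun Z ↦ eq_of_two_smul_eq ?_
  -- What remains is P(X,Y,Z) + h(X,JY,Z) + h(X,Y,JZ) = 0. In the sum of these two instances of
  -- `h_eq` the terms P(Y,X,Z) and P(Z,X,Y) cancel, leaving -2P(X,Y,Z).
  have e1 := h_eq X (J Y) Z
  have e2 := h_eq X Y (J Z)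
  rw [P_J, P_int, hJ, hJ, P_neg, P_neg, P_neg] at e1
  rw [P_int, hJ, hJ, P_neg, P_neg, P_neg] at e2
  have e3 := P_eq X Y Z
  simp only [LinearMap.add_apply, map_add, hJg', hB]
  linear_combination (norm := module) e1 + e2 - (2 : ℝ) • e3

/-- If `∇ - B` preserves a complex structure `J`, and the torsion `3`-form is closed, then the curvature of
`∇ + B` is of type `(1, 1)` with respect to `J`. -/
theorem curv_bismut_apply_J (J : V →ₗ[ℝ] V) (hJg : ∀ X Y, 𝒜.g (J X) (J Y) = 𝒜.g X Y)
    (h : V → V → V → C) (B : V →ₗ[ℝ] V →ₗ[ℝ] V)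
    (hB : ∀ X Y Z, 𝒜.g (B X Y) Z = h X Y Z) (h_swap : ∀ X Y Z, h X Y Z = -h Y X Z)
    (h_swap' : ∀ X Y Z, h X Y Z = -h X Z Y) (hd : ∀ X Y Z W, 𝒜.dThree h X Y Z W = 0)
    (hJ : ∀ X Y, (𝒜.nab - B) X (J Y) = J ((𝒜.nab - B) X Y)) (X Y Z : V) :
    𝒜.curv (𝒜.nab + B) (J X) (J Y) Z = 𝒜.curv (𝒜.nab + B) X Y Z := by
  refine 𝒜.g_ext _ _ fun W ↦ ?_
  -- Exchange puts JX and JY into the last two slots of the curvature of ∇ - B. That curvature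
  -- commutes with J, and g is J-invariant.
  rw [𝒜.g_curv_bismut_pair_symm h B hB h_swap h_swap' hd,
    𝒜.g_curv_bismut_pair_symm h B hB h_swap h_swap' hd,
    ← hJg (𝒜.curv (𝒜.nab - B) Z W X)]
  simp only [curv, hJ, map_sub]

end FieldCalculus

/-! ### Smooth vector fields and functions -/

section Fields

variable {E : Type*} [NormedAddCommGroup E] [NormedSpace ℝ E] [FiniteDimensional ℝ E]
  {M : Type*} [TopologicalSpace M] [ChartedSpace E M] [IsManifold 𝓘(ℝ, E) ∞ M]

theorem two_le_infty : (2 : WithTop ℕ∞) ≤ ∞ := WithTop.coe_le_coe.2 le_top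

/-- Cutting off with a bump function. The calculus below concerns globally smooth fields, and local
or pointwise claims are reached through such extensions; Hausdorffness is what provides the bump
functions. -/
theorem exists_smooth_eventuallyEq [T2Space M] {V : Π x : M, TangentSpace 𝓘(ℝ, E) x} {u : Set M}
    {x : M} (hu : u ∈ nhds x) (hV : CMDiff[u] ∞ (T% V)) :
    ∃ W : Π x : M, TangentSpace 𝓘(ℝ, E) x, CMDiff ∞ (T% W) ∧ ∀ᶠ y in nhds x, W y = V y := by
  obtain ⟨f, -, hf⟩ := (SmoothBumpFunction.nhds_basis_tsupport (I := 𝓘(ℝ, E)) x).mem_iff.1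
    (interior_mem_nhds.2 hu)
  refine ⟨fun y ↦ f y • V y, ContMDiffOn.smul_section_of_tsupport f.contMDiff.contMDiffOn
    isOpen_interior hf (hV.mono interior_subset), ?_⟩
  filter_upwards [f.eventuallyEq_one] with y hy
  simp [hy]

theorem exists_smooth_apply_eq [T2Space M] (x : M) (v : TangentSpace 𝓘(ℝ, E) x) :
    ∃ W : Π x : M, TangentSpace 𝓘(ℝ, E) x, CMDiff ∞ (T% W) ∧ W x = v := by
  obtain ⟨u, hu, h⟩ := FiberBundle.exists_contMDiffOn_extend (k := ∞) 𝓘(ℝ, E) E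
    (V := fun x : M ↦ TangentSpace 𝓘(ℝ, E) x) v
  obtain ⟨W, hW, h'⟩ := exists_smooth_eventuallyEq hu h
  exact ⟨W, hW, by rw [h'.self_of_nhds, FiberBundle.extend_apply_self]⟩

theorem Metric.smooth (g : Metric E M) {X Y : Π x : M, TangentSpace 𝓘(ℝ, E) x} {x : M}
    (hX : CMDiffAt ∞ (T% X) x) (hY : CMDiffAt ∞ (T% Y) x) :
    ContMDiffAt 𝓘(ℝ, E) 𝓘(ℝ, ℝ) ∞ (fun y ↦ g.inner y (X y) (Y y)) x := by
  have h := ContMDiffAt.clm_bundle_apply₂ (𝕜 := ℝ) (F₁ := E) (F₂ := E) (F₃ := ℝ)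
    (E₁ := fun x : M ↦ TangentSpace 𝓘(ℝ, E) x) (E₂ := fun x : M ↦ TangentSpace 𝓘(ℝ, E) x)
    (E₃ := Bundle.Trivial M ℝ) (b := fun y => y) (x := x)
    (g.contMDiff x) hX hY
  rw [contMDiffAt_totalSpace] at h
  exact h.2

theorem HermitianStructure.smooth_apply {g : Metric E M} (S : HermitianStructure g)
    {X : Π x : M, TangentSpace 𝓘(ℝ, E) x} (hX : CMDiff ∞ (T% X)) :
    CMDiff ∞ (T% (fun y ↦ S.J y (X y))) := fun x ↦
  ContMDiffAt.clm_bundle_apply (𝕜 := ℝ) (F₁ := E) (F₂ := E)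
    (E₁ := fun x : M ↦ TangentSpace 𝓘(ℝ, E) x) (E₂ := fun x : M ↦ TangentSpace 𝓘(ℝ, E) x)
    (b := fun y => y) (x := x) (S.smooth x) (hX x)

theorem smooth_mlieBracket {X Y : Π x : M, TangentSpace 𝓘(ℝ, E) x}
    (hX : CMDiff ∞ (T% X)) (hY : CMDiff ∞ (T% Y)) :
    CMDiff ∞ (T% (mlieBracket 𝓘(ℝ, E) X Y)) :=
  have : IsManifold 𝓘(ℝ, E) (minSmoothness ℝ 2) M :=
    IsManifold.of_le (n := ∞) (by simpa using two_le_infty)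
  -- Since ∞ + 1 = ∞, the derivative lost by the bracket costs nothing.
  have : IsManifold 𝓘(ℝ, E) ((⊤ : ℕ∞) + 1) M := inferInstanceAs (IsManifold 𝓘(ℝ, E) ∞ M)
  ContDiff.mlieBracket_vectorField (m := ⊤) (n := ⊤) hX hY (by simp)

/-- The function df(X) is the fibre component of the tangent map of f composed with X. -/
theorem smooth_mvfderiv {f : M → ℝ} {X : Π x : M, TangentSpace 𝓘(ℝ, E) x}
    (hf : ContMDiff 𝓘(ℝ, E) 𝓘(ℝ, ℝ) ∞ f) (hX : CMDiff ∞ (T% X)) :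
    ContMDiff 𝓘(ℝ, E) 𝓘(ℝ, ℝ) ∞ (fun y ↦ d% f y (X y)) :=
  (contMDiff_snd_tangentBundle_modelSpace ℝ 𝓘(ℝ, ℝ)).comp
    ((hf.contMDiff_tangentMap (m := ∞) (by simp)).comp hX)

/-- The derivative at `e` of the inverse of the preferred chart at `x`. -/
abbrev chartInv (x : M) (e : E) : E →L[ℝ] TangentSpace 𝓘(ℝ, E) ((extChartAt 𝓘(ℝ, E) x).symm e) :=
  mfderiv 𝓘(ℝ, E) 𝓘(ℝ, E) (extChartAt 𝓘(ℝ, E) x).symm e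

/-- The coordinate expression of a vector field in the preferred chart at `x`. -/
def coordField (X : Π x : M, TangentSpace 𝓘(ℝ, E) x) (x : M) (e : E) : E :=
  (chartInv x e).inverse (X ((extChartAt 𝓘(ℝ, E) x).symm e))

theorem isInvertible_chartInv {x : M} {e : E} (he : e ∈ (extChartAt 𝓘(ℝ, E) x).target) :
    (chartInv x e).IsInvertible := by
  have : IsManifold 𝓘(ℝ, E) 1 M := IsManifold.of_le (n := ∞) (by simp)
  have h := isInvertible_mfderivWithin_extChartAt_symm he
  rwa [ModelWithCorners.range_eq_univ, mfderivWithin_univ] at h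

theorem chartInv_coordField (X : Π x : M, TangentSpace 𝓘(ℝ, E) x) {x : M} {e : E}
    (he : e ∈ (extChartAt 𝓘(ℝ, E) x).target) :
    chartInv x e (coordField X x e) = X ((extChartAt 𝓘(ℝ, E) x).symm e) := by
  obtain ⟨A, hA⟩ := isInvertible_chartInv he
  rw [coordField, ← hA, ContinuousLinearMap.inverse_equiv]
  exact A.apply_symm_apply _

/-- The tangent space at x is identified with E by the preferred chart at x, so this chart has
derivative the identity there. Hence vectors, brackets and forms at x equal their coordinate
expressions. -/
theorem chartInv_self (x : M) (v : E) :
    (chartInv x (extChartAt 𝓘(ℝ, E) x x) v : E) = v := by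
  have : IsManifold 𝓘(ℝ, E) 1 M := IsManifold.of_le (n := ∞) (by simp)
  have h := mfderivWithin_range_extChartAt_symm (I := 𝓘(ℝ, E)) (x := x)
  rw [ModelWithCorners.range_eq_univ, mfderivWithin_univ] at h
  exact congrArg (fun f : E →L[ℝ] E ↦ f v) h

/-- Going to the chart and back gives a point only propositionally equal to x; comparing in the
model space E avoids a cast between tangent spaces. -/
theorem congr_field {X : Π x : M, TangentSpace 𝓘(ℝ, E) x} {x y : M} (h : x = y) :
    (X x : E) = X y := by
  subst h; rfl

theorem coordField_self (X : Π x : M, TangentSpace 𝓘(ℝ, E) x) (x : M) :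
    coordField X x (extChartAt 𝓘(ℝ, E) x x) = X x :=
  (chartInv_self x _).symm.trans
    ((chartInv_coordField X (mem_extChartAt_target x)).trans (congr_field (extChartAt_to_inv x)))

theorem differentiableAt_coordField {X : Π x : M, TangentSpace 𝓘(ℝ, E) x} {x : M}
    (hX : MDiffAt (T% X) x) :
    DifferentiableAt ℝ (coordField X x) (extChartAt 𝓘(ℝ, E) x x) := by
  have : IsManifold 𝓘(ℝ, E) 2 M := IsManifold.of_le (n := ∞) two_le_infty
  have h := MDifferentiableWithinAt.differentiableWithinAt_mpullbackWithin_vectorField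
    (s := Set.univ) hX.mdifferentiableWithinAt
  rw [ModelWithCorners.range_eq_univ, Set.preimage_univ, Set.inter_univ,
    mpullbackWithin_univ] at h
  exact differentiableWithinAt_univ.1 h

theorem mlieBracket_eq_coord (X Y : Π x : M, TangentSpace 𝓘(ℝ, E) x) (x : M) :
    mlieBracket 𝓘(ℝ, E) X Y x
      = lieBracket ℝ (coordField X x) (coordField Y x) (extChartAt 𝓘(ℝ, E) x x) := by
  have : IsManifold 𝓘(ℝ, E) 1 M := IsManifold.of_le (n := ∞) (by simp)
  have h : mlieBracket 𝓘(ℝ, E) X Y x = (ContinuousLinearMap.id ℝ E).inverse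
      (lieBracketWithin ℝ (coordField X x) (coordField Y x) Set.univ (extChartAt 𝓘(ℝ, E) x x)) := by
    rw [← mlieBracketWithin_univ, mlieBracketWithin_apply, mfderiv_extChartAt_self,
      ModelWithCorners.range_eq_univ, Set.preimage_univ, Set.inter_univ, mpullbackWithin_univ,
      mpullbackWithin_univ]
    rfl
  rw [h, lieBracketWithin_univ, ContinuousLinearMap.inverse_id]
  rfl

theorem mvfderiv_eq_coord {f : M → ℝ} (X : Π x : M, TangentSpace 𝓘(ℝ, E) x) {x : M} {e : E}
    (he : e ∈ (extChartAt 𝓘(ℝ, E) x).target) (hf : MDiffAt f ((extChartAt 𝓘(ℝ, E) x).symm e)) :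
    d% f ((extChartAt 𝓘(ℝ, E) x).symm e) (X ((extChartAt 𝓘(ℝ, E) x).symm e))
      = fderiv ℝ (f ∘ (extChartAt 𝓘(ℝ, E) x).symm) e (coordField X x e) := by
  have : IsManifold 𝓘(ℝ, E) 1 M := IsManifold.of_le (n := ∞) (by simp)
  have h := mdifferentiableWithinAt_extChartAt_symm he
  rw [ModelWithCorners.range_eq_univ, mdifferentiableWithinAt_univ] at h
  rw [← chartInv_coordField X he, ← mfderiv_eq_fderiv, mfderiv_comp (I' := 𝓘(ℝ, E)) e hf h]
  rfl

theorem mvfderiv_self_eq_coord {f : M → ℝ} (X : Π x : M, TangentSpace 𝓘(ℝ, E) x) {x : M}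
    (hf : MDiffAt f x) :
    d% f x (X x) = fderiv ℝ (f ∘ (extChartAt 𝓘(ℝ, E) x).symm) (extChartAt 𝓘(ℝ, E) x x) (X x : E) := by
  have hx := extChartAt_to_inv (I := 𝓘(ℝ, E)) x
  rw [← coordField_self X x, ← mvfderiv_eq_coord X (mem_extChartAt_target x) (by rwa [hx]), hx]
  exact congrArg (d% f x) (coordField_self X x)

theorem contDiffAt_coord {f : M → ℝ} (hf : ContMDiff 𝓘(ℝ, E) 𝓘(ℝ, ℝ) ∞ f) {x : M} {e : E}
    (he : e ∈ (extChartAt 𝓘(ℝ, E) x).target) :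
    ContDiffAt ℝ ∞ (f ∘ (extChartAt 𝓘(ℝ, E) x).symm) e :=
  (hf.contMDiffAt.comp e ((contMDiffOn_extChartAt_symm x).contMDiffAt
    ((isOpen_extChartAt_target x).mem_nhds he))).contDiffAt

/-- In the chart at x, the second derivatives of f cancel by symmetry and what is left is df applied
to the coordinate bracket. -/
theorem mvfderiv_mlieBracket {f : M → ℝ} (hf : ContMDiff 𝓘(ℝ, E) 𝓘(ℝ, ℝ) ∞ f)
    {X Y : Π x : M, TangentSpace 𝓘(ℝ, E) x} (hX : CMDiff ∞ (T% X)) (hY : CMDiff ∞ (T% Y)) (x : M) :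
    d% f x (mlieBracket 𝓘(ℝ, E) X Y x)
      = d% (fun y ↦ d% f y (Y y)) x (X x) - d% (fun y ↦ d% f y (X y)) x (Y x) := by
  set e := extChartAt 𝓘(ℝ, E) x x
  have he : e ∈ (extChartAt 𝓘(ℝ, E) x).target := mem_extChartAt_target x
  -- The product rule in the chart: X(Yf) = D²f(X,Y) + Df(DY·X).
  have h (X Y : Π x : M, TangentSpace 𝓘(ℝ, E) x) (hX : CMDiff ∞ (T% X)) (hY : CMDiff ∞ (T% Y)) :
      d% (fun y ↦ d% f y (Y y)) x (X x)
        = fderiv ℝ (fderiv ℝ (f ∘ (extChartAt 𝓘(ℝ, E) x).symm)) e (coordField X x e) (coordField Y x e)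
          + fderiv ℝ (f ∘ (extChartAt 𝓘(ℝ, E) x).symm) e
            (fderiv ℝ (coordField Y x) e (coordField X x e)) := by
    rw [mvfderiv_self_eq_coord X ((smooth_mvfderiv hf hY).mdifferentiable (by simp) x),
      ← coordField_self X x]
    have : (fun y ↦ d% f y (Y y)) ∘ (extChartAt 𝓘(ℝ, E) x).symm
        =ᶠ[nhds e] fun e ↦ fderiv ℝ (f ∘ (extChartAt 𝓘(ℝ, E) x).symm) e (coordField Y x e) := by
      filter_upwards [(isOpen_extChartAt_target x).mem_nhds he] with e he
      exact mvfderiv_eq_coord Y he (hf.mdifferentiable (by simp) _)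
    rw [this.fderiv_eq, fderiv_clm_apply
      (((contDiffAt_coord hf he).fderiv_right (m := ∞) (by simp)).differentiableAt (by simp))
      (differentiableAt_coordField (hY.mdifferentiable (by simp) x))]
    simp [add_comm, e]
  rw [h X Y hX hY, h Y X hY hX, mvfderiv_self_eq_coord (mlieBracket 𝓘(ℝ, E) X Y)
    (hf.mdifferentiable (by simp) x), mlieBracket_eq_coord,
    ((contDiffAt_coord hf he).isSymmSndFDerivAt (by simpa using two_le_infty)).eq
      (coordField X x e)]
  simp [lieBracket, e]

end Fields

/-! ### The exterior derivative of a smooth form -/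

section Forms

variable {E : Type*} [NormedAddCommGroup E] [NormedSpace ℝ E] [FiniteDimensional ℝ E]
  {M : Type*} [TopologicalSpace M] [ChartedSpace E M] [IsManifold 𝓘(ℝ, E) ∞ M]

/-- A form is smooth if its values on smooth vector fields are smooth functions. -/
def SmoothForm {k : ℕ} (α : DForm E M k) : Prop :=
  ∀ X : Fin k → Π x : M, TangentSpace 𝓘(ℝ, E) x, (∀ i, CMDiff ∞ (T% (X i))) →
    ContMDiff 𝓘(ℝ, E) 𝓘(ℝ, ℝ) ∞ fun x ↦ α x fun i ↦ X i x

/-- The coordinate expression of a form in the preferred chart at `x`. -/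
def coordForm {k : ℕ} (α : DForm E M k) (x : M) (e : E) : E [⋀^Fin k]→L[ℝ] ℝ :=
  (α ((extChartAt 𝓘(ℝ, E) x).symm e)).compContinuousLinearMap (chartInv x e)

theorem coordForm_coordField {k : ℕ} (α : DForm E M k) (X : Fin k → Π x : M, TangentSpace 𝓘(ℝ, E) x)
    {x : M} {e : E} (he : e ∈ (extChartAt 𝓘(ℝ, E) x).target) :
    coordForm α x e (fun i ↦ coordField (X i) x e)
      = α ((extChartAt 𝓘(ℝ, E) x).symm e) fun i ↦ X i ((extChartAt 𝓘(ℝ, E) x).symm e) :=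
  congrArg (α ((extChartAt 𝓘(ℝ, E) x).symm e)) (funext fun i ↦ chartInv_coordField (X i) he)

theorem coordForm_self {k : ℕ} (α : DForm E M k) (x : M) (v : Fin k → E) :
    coordForm α x (extChartAt 𝓘(ℝ, E) x x) v = α x v := by
  have h : (fun i ↦ chartInv x (extChartAt 𝓘(ℝ, E) x x) (v i) : Fin k → E) = v :=
    funext fun i ↦ chartInv_self x (v i)
  have h' {y : M} (hy : y = x) (w : Fin k → E) : α y w = α x w := by
    subst hy; rfl
  exact (h' (extChartAt_to_inv x) _).trans (congrArg (α x) h)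

theorem extD_apply {k : ℕ} (α : DForm E M k) (x : M) (v : Fin (k + 1) → E) :
    extD α x v = extDeriv (coordForm α x) (extChartAt 𝓘(ℝ, E) x x) v := by
  have : IsManifold 𝓘(ℝ, E) 1 M := IsManifold.of_le (n := ∞) (by simp)
  have h : (fun i ↦ mfderiv 𝓘(ℝ, E) 𝓘(ℝ, E) (extChartAt 𝓘(ℝ, E) x) x (v i) : Fin (k + 1) → E) = v := by
    rw [mfderiv_extChartAt_self]
    rfl
  exact congrArg (extDeriv (coordForm α x) (extChartAt 𝓘(ℝ, E) x x)) h

/-- The pullback of a constant field by the chart, cut off away from x. On such fields a form takes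
the values of its coordinate expression on fixed vectors, so `SmoothForm` yields differentiability
of the coefficients. -/
theorem exists_smooth_coordField_eq [T2Space M] (x : M) (v : E) :
    ∃ W : Π x : M, TangentSpace 𝓘(ℝ, E) x, CMDiff ∞ (T% W) ∧
      ∀ᶠ e in nhds (extChartAt 𝓘(ℝ, E) x x), coordField W x e = v := by
  have : IsManifold 𝓘(ℝ, E) 1 M := IsManifold.of_le (n := ∞) (by simp)
  let V : Π x : M, TangentSpace 𝓘(ℝ, E) x :=
    mpullback 𝓘(ℝ, E) 𝓘(ℝ, E) (extChartAt 𝓘(ℝ, E) x) fun _ ↦ v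
  have hV : CMDiff[(extChartAt 𝓘(ℝ, E) x).source] ∞ (T% V) := fun y hy ↦
    (ContMDiffAt.mpullback_vectorField_preimage (m := ∞) (n := ∞)
      (contMDiffAt_vectorSpace_iff_contDiffAt.2 contDiffAt_const)
      (contMDiffAt_extChartAt' (by simpa using hy))
      (isInvertible_mfderiv_extChartAt hy) (by simp)).contMDiffWithinAt
  obtain ⟨W, hW, h⟩ := exists_smooth_eventuallyEq (extChartAt_source_mem_nhds x) hV
  refine ⟨W, hW, ?_⟩
  have hc : ContinuousAt (extChartAt 𝓘(ℝ, E) x).symm (extChartAt 𝓘(ℝ, E) x x) :=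
    continuousAt_extChartAt_symm x
  filter_upwards [(isOpen_extChartAt_target x).mem_nhds (mem_extChartAt_target x),
    hc.eventually (by rwa [extChartAt_to_inv])] with e he hWe
  have h₁ := mfderiv_extChartAt_comp_mfderivWithin_extChartAt_symm he
  have h₂ := mfderivWithin_extChartAt_symm_comp_mfderiv_extChartAt he
  rw [ModelWithCorners.range_eq_univ, mfderivWithin_univ] at h₁ h₂
  obtain ⟨A, hA⟩ := isInvertible_chartInv he
  have hv : V ((extChartAt 𝓘(ℝ, E) x).symm e) = chartInv x e v :=
    DFunLike.congr_fun (ContinuousLinearMap.inverse_eq h₁ h₂) v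
  rw [coordField, hWe, hv, ← hA, ContinuousLinearMap.inverse_equiv]
  exact A.symm_apply_apply _

/-- An alternating map is determined by its values on tuples of basis vectors. A linear left inverse
L of this evaluation T recovers β as L ∘ T ∘ β from finitely many differentiable functions. -/
theorem differentiableAt_continuousAlternatingMap {k : ℕ} {β : E → E [⋀^Fin k]→L[ℝ] ℝ} {e : E}
    (h : ∀ v, DifferentiableAt ℝ (fun e ↦ β e v) e) : DifferentiableAt ℝ β e := by
  let b := Module.finBasis ℝ E
  let T : (E [⋀^Fin k]→L[ℝ] ℝ) →ₗ[ℝ] (Fin k → Fin (Module.finrank ℝ E)) → ℝ :=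
    { toFun := fun γ i ↦ γ fun j ↦ b (i j)
      map_add' := fun _ _ ↦ rfl
      map_smul' := fun _ _ ↦ rfl }
  have hT : LinearMap.ker T = ⊥ := by
    refine LinearMap.ker_eq_bot'.2 fun γ hγ ↦ ?_
    refine ContinuousAlternatingMap.toAlternatingMap_injective
      (AlternatingMap.coe_multilinearMap_injective (Module.Basis.ext_multilinear (fun _ ↦ b) fun i ↦ ?_))
    exact congrFun hγ i
  obtain ⟨L, hL⟩ := T.exists_leftInverse_of_injective hT
  have : β = fun e ↦ L.toContinuousLinearMap (T (β e)) :=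
    funext fun e ↦ (LinearMap.congr_fun hL (β e)).symm
  rw [this]
  exact L.toContinuousLinearMap.differentiableAt.comp e
    (differentiableAt_pi.2 fun i ↦ h fun j ↦ b (i j))

theorem SmoothForm.differentiableAt_coordForm [T2Space M] {k : ℕ} {α : DForm E M k}
    (hα : SmoothForm α) (x : M) :
    DifferentiableAt ℝ (coordForm α x) (extChartAt 𝓘(ℝ, E) x x) := by
  refine differentiableAt_continuousAlternatingMap fun v ↦ ?_
  choose W hW h using fun i ↦ exists_smooth_coordField_eq x (v i)
  refine ((contDiffAt_coord (hα W hW) (mem_extChartAt_target x)).differentiableAt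
    (by simp)).congr_of_eventuallyEq ?_
  filter_upwards [(isOpen_extChartAt_target x).mem_nhds (mem_extChartAt_target x),
    Filter.eventually_all.2 h] with e he hv
  rw [Function.comp_apply, ← coordForm_coordField α W he]
  simp only [hv]

/-- Cartan's invariant formula. It holds on E for the coordinate expressions, and at x each of its
ingredients agrees with its expression in the preferred chart. -/
theorem SmoothForm.extD_apply [T2Space M] {k : ℕ} {α : DForm E M (k + 1)} (hα : SmoothForm α)
    (X : Fin (k + 2) → Π x : M, TangentSpace 𝓘(ℝ, E) x) (hX : ∀ i, CMDiff ∞ (T% (X i))) (x : M) :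
    extD α x (fun i ↦ X i x) =
      (∑ i, (-1) ^ i.val • d% (fun y ↦ α y (i.removeNth fun j ↦ X j y)) x (X i x)) -
        ∑ i : Fin (k + 1), ∑ j ≥ i, (-1) ^ (i + j : ℕ) •
          α x (Matrix.vecCons (mlieBracket 𝓘(ℝ, E) (X i.castSucc) (X j.succ) x)
            (j.removeNth <| i.castSucc.removeNth fun l ↦ X l x)) := by
  have hc : (fun i ↦ X i x : Fin (k + 2) → E)
      = fun i ↦ coordField (X i) x (extChartAt 𝓘(ℝ, E) x x) :=
    funext fun i ↦ (coordField_self (X i) x).symm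
  have h := extDeriv_apply_vectorField (hα.differentiableAt_coordForm x)
    (V := fun i ↦ coordField (X i) x)
    fun i ↦ differentiableAt_coordField ((hX i).mdifferentiable (by simp) x)
  refine (GK.extD_apply α x _).trans ((congrArg _ hc).trans (h.trans ?_))
  congr 1
  · refine Finset.sum_congr rfl fun i _ ↦ ?_
    congr 1
    have hs := hα (i.removeNth X) fun j ↦ hX _
    refine Eq.trans ?_ (mvfderiv_self_eq_coord (X i) (hs.mdifferentiable (by simp) x)).symm
    rw [coordField_self]
    refine congrArg (fun L : E →L[ℝ] ℝ ↦ L (X i x)) (Filter.EventuallyEq.fderiv_eq ?_)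
    filter_upwards [(isOpen_extChartAt_target x).mem_nhds (mem_extChartAt_target x)] with e he
    exact coordForm_coordField α (i.removeNth X) he
  · refine Finset.sum_congr rfl fun i _ ↦ Finset.sum_congr rfl fun j _ ↦ ?_
    congr 1
    rw [coordForm_self, mlieBracket_eq_coord, ← hc]
    rfl

/-! ### The invariant formula written out for 2-forms and 3-forms. -/

theorem eq_vec_two {A : Type*} (v : Fin 2 → A) : v = ![v 0, v 1] := by
  ext i; fin_cases i <;> rfl

theorem eq_vec_three {A : Type*} (v : Fin 3 → A) : v = ![v 0, v 1, v 2] := by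
  ext i; fin_cases i <;> rfl

theorem eq_vec_four {A : Type*} (v : Fin 4 → A) : v = ![v 0, v 1, v 2, v 3] := by
  ext i; fin_cases i <;> rfl

/-- `G i j` is the term of the bracket of the fields numbered i and j + 1, so the range j ≥ i meets
each pair of fields once. -/
theorem sum_sub_sum_two (F : Fin 3 → ℝ) (G : Fin 2 → Fin 2 → ℝ) :
    (∑ i, (-1) ^ i.val • F i) - ∑ i : Fin 2, ∑ j ≥ i, (-1) ^ (i + j : ℕ) • G i j
      = F 0 - F 1 + F 2 - G 0 0 + G 0 1 - G 1 1 := by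
  have I0 : Finset.Ici (0 : Fin 2) = {0, 1} := by decide
  have I1 : Finset.Ici (1 : Fin 2) = {1} := by decide
  simp [Fin.sum_univ_succ, I0, I1]
  ring

theorem sum_sub_sum_three (F : Fin 4 → ℝ) (G : Fin 3 → Fin 3 → ℝ) :
    (∑ i, (-1) ^ i.val • F i) - ∑ i : Fin 3, ∑ j ≥ i, (-1) ^ (i + j : ℕ) • G i j
      = F 0 - F 1 + F 2 - F 3 - G 0 0 + G 0 1 - G 0 2 - G 1 1 + G 1 2 - G 2 2 := by
  have I0 : Finset.Ici (0 : Fin 3) = {0, 1, 2} := by decide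
  have I1 : Finset.Ici (1 : Fin 3) = {1, 2} := by decide
  have I2 : Finset.Ici (2 : Fin 3) = {2} := by decide
  simp [Fin.sum_univ_four, Fin.sum_univ_three, I0, I1, I2]
  ring

theorem SmoothForm.smooth_two {α : DForm E M 2} (hα : SmoothForm α)
    {X Y : Π x : M, TangentSpace 𝓘(ℝ, E) x} (hX : CMDiff ∞ (T% X)) (hY : CMDiff ∞ (T% Y)) :
    ContMDiff 𝓘(ℝ, E) 𝓘(ℝ, ℝ) ∞ fun x ↦ α x ![X x, Y x] := by
  convert hα ![X, Y] (by intro i; fin_cases i <;> assumption) using 3 with x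
  ext i; fin_cases i <;> rfl

theorem SmoothForm.smooth_three {α : DForm E M 3} (hα : SmoothForm α)
    {X Y Z : Π x : M, TangentSpace 𝓘(ℝ, E) x} (hX : CMDiff ∞ (T% X)) (hY : CMDiff ∞ (T% Y))
    (hZ : CMDiff ∞ (T% Z)) : ContMDiff 𝓘(ℝ, E) 𝓘(ℝ, ℝ) ∞ fun x ↦ α x ![X x, Y x, Z x] := by
  convert hα ![X, Y, Z] (by intro i; fin_cases i <;> assumption) using 3 with x
  ext i; fin_cases i <;> rfl

theorem SmoothForm.extD_two [T2Space M] {α : DForm E M 2} (hα : SmoothForm α)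
    {X Y Z : Π x : M, TangentSpace 𝓘(ℝ, E) x} (hX : CMDiff ∞ (T% X)) (hY : CMDiff ∞ (T% Y))
    (hZ : CMDiff ∞ (T% Z)) (x : M) :
    extD α x ![X x, Y x, Z x] = d% (fun y ↦ α y ![Y y, Z y]) x (X x)
      - d% (fun y ↦ α y ![X y, Z y]) x (Y x) + d% (fun y ↦ α y ![X y, Y y]) x (Z x)
      - α x ![mlieBracket 𝓘(ℝ, E) X Y x, Z x] + α x ![mlieBracket 𝓘(ℝ, E) X Z x, Y x]
      - α x ![mlieBracket 𝓘(ℝ, E) Y Z x, X x] := by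
  have h := hα.extD_apply ![X, Y, Z] (by intro i; fin_cases i <;> assumption) x
  rw [eq_vec_three (fun i ↦ ![X, Y, Z] i x)] at h
  refine h.trans ((sum_sub_sum_two _ _).trans ?_)
  refine congrArg₂ (· - ·) (congrArg₂ (· + ·) (congrArg₂ (· - ·) (congrArg₂ (· + ·)
    (congrArg₂ (· - ·) ?_ ?_) ?_) ?_) ?_) ?_
  · exact congrArg (fun f : M → ℝ ↦ d% f x (X x)) (funext fun y ↦ congrArg (α y) (eq_vec_two _))
  · exact congrArg (fun f : M → ℝ ↦ d% f x (Y x)) (funext fun y ↦ congrArg (α y) (eq_vec_two _))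
  · exact congrArg (fun f : M → ℝ ↦ d% f x (Z x)) (funext fun y ↦ congrArg (α y) (eq_vec_two _))
  all_goals exact congrArg (α x) (eq_vec_two _)

theorem SmoothForm.extD_three [T2Space M] {α : DForm E M 3} (hα : SmoothForm α)
    {X Y Z W : Π x : M, TangentSpace 𝓘(ℝ, E) x} (hX : CMDiff ∞ (T% X)) (hY : CMDiff ∞ (T% Y))
    (hZ : CMDiff ∞ (T% Z)) (hW : CMDiff ∞ (T% W)) (x : M) :
    extD α x ![X x, Y x, Z x, W x] = d% (fun y ↦ α y ![Y y, Z y, W y]) x (X x)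
      - d% (fun y ↦ α y ![X y, Z y, W y]) x (Y x) + d% (fun y ↦ α y ![X y, Y y, W y]) x (Z x)
      - d% (fun y ↦ α y ![X y, Y y, Z y]) x (W x)
      - α x ![mlieBracket 𝓘(ℝ, E) X Y x, Z x, W x] + α x ![mlieBracket 𝓘(ℝ, E) X Z x, Y x, W x]
      - α x ![mlieBracket 𝓘(ℝ, E) X W x, Y x, Z x] - α x ![mlieBracket 𝓘(ℝ, E) Y Z x, X x, W x]
      + α x ![mlieBracket 𝓘(ℝ, E) Y W x, X x, Z x]
      - α x ![mlieBracket 𝓘(ℝ, E) Z W x, X x, Y x] := by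
  have h := hα.extD_apply ![X, Y, Z, W] (by intro i; fin_cases i <;> assumption) x
  rw [eq_vec_four (fun i ↦ ![X, Y, Z, W] i x)] at h
  refine h.trans ((sum_sub_sum_three _ _).trans ?_)
  refine congrArg₂ (· - ·) (congrArg₂ (· + ·) (congrArg₂ (· - ·) (congrArg₂ (· - ·)
    (congrArg₂ (· + ·) (congrArg₂ (· - ·) (congrArg₂ (· - ·) (congrArg₂ (· + ·)
    (congrArg₂ (· - ·) ?_ ?_) ?_) ?_) ?_) ?_) ?_) ?_) ?_) ?_
  · exact congrArg (fun f : M → ℝ ↦ d% f x (X x)) (funext fun y ↦ congrArg (α y) (eq_vec_three _))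
  · exact congrArg (fun f : M → ℝ ↦ d% f x (Y x)) (funext fun y ↦ congrArg (α y) (eq_vec_three _))
  · exact congrArg (fun f : M → ℝ ↦ d% f x (Z x)) (funext fun y ↦ congrArg (α y) (eq_vec_three _))
  · exact congrArg (fun f : M → ℝ ↦ d% f x (W x)) (funext fun y ↦ congrArg (α y) (eq_vec_three _))
  all_goals exact congrArg (α x) (eq_vec_three _)

end Forms

/-! ### Smoothness of the Levi-Civita connection -/

section Smoothness

variable {E : Type*} [NormedAddCommGroup E] [NormedSpace ℝ E] [FiniteDimensional ℝ E]
  {M : Type*} [TopologicalSpace M] [ChartedSpace E M] [IsManifold 𝓘(ℝ, E) ∞ M]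

theorem contMDiffAt_det {ι : Type*} [Fintype ι] [DecidableEq ι] {A : M → Matrix ι ι ℝ} {x : M}
    (hA : ∀ i j, ContMDiffAt 𝓘(ℝ, E) 𝓘(ℝ, ℝ) ∞ (fun y ↦ A y i j) x) :
    ContMDiffAt 𝓘(ℝ, E) 𝓘(ℝ, ℝ) ∞ (fun y ↦ (A y).det) x := by
  simp only [Matrix.det_apply']
  refine contMDiffAt_finsetSum fun σ _ ↦ contMDiffAt_const.mul ?_
  exact contMDiffAt_finsetProd fun i _ ↦ hA _ _

theorem Metric.ext_inner (g : Metric E M) {x : M} {v w : TangentSpace 𝓘(ℝ, E) x}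
    (h : ∀ u, g.inner x v u = g.inner x w u) : v = w :=
  (g.flat x).injective (ContinuousLinearMap.ext h)

theorem Metric.inner_self_eq_zero (g : Metric E M) {x : M} {v : TangentSpace 𝓘(ℝ, E) x}
    (h : g.inner x v v = 0) : v = 0 := by
  by_contra hv
  exact (g.pos x v hv).ne' h

/-- A vector field is smooth if its inner products with smooth vector fields are smooth. -/
theorem Metric.smooth_of_inner [T2Space M] (g : Metric E M) {Z : Π x : M, TangentSpace 𝓘(ℝ, E) x}
    (hZ : ∀ W : Π x : M, TangentSpace 𝓘(ℝ, E) x, CMDiff ∞ (T% W) →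
      ContMDiff 𝓘(ℝ, E) 𝓘(ℝ, ℝ) ∞ fun y ↦ g.inner y (Z y) (W y)) : CMDiff ∞ (T% Z) := by
  intro x
  let b : Module.Basis (Fin (Module.finrank ℝ E)) ℝ (TangentSpace 𝓘(ℝ, E) x) :=
    Module.finBasis ℝ E
  -- Global smooth fields that form a basis at x, with Gram matrix A.
  choose e he heb using fun i ↦ exists_smooth_apply_eq x (b i)
  let A (y : M) : Matrix (Fin (Module.finrank ℝ E)) (Fin (Module.finrank ℝ E)) ℝ :=
    Matrix.of fun i j ↦ g.inner y (e i y) (e j y)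
  have hA (i j) : ContMDiffAt 𝓘(ℝ, E) 𝓘(ℝ, ℝ) ∞ (fun y ↦ A y i j) x := g.smooth (he i x) (he j x)
  have hAv (y : M) (c : Fin (Module.finrank ℝ E) → ℝ) (i) :
      (A y).mulVec c i = g.inner y (e i y) (∑ j, c j • e j y) := by
    simp [A, Matrix.mulVec, dotProduct, mul_comm]
  -- A kernel vector of the Gram matrix gives a combination of the e_i(x) of norm zero, against
  -- linear independence.
  have hdet : (A x).det ≠ 0 := by
    intro h0
    obtain ⟨c, hc, hAc⟩ := Matrix.exists_mulVec_eq_zero_iff.2 h0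
    have : ∑ j, c j • e j x = 0 := by
      refine g.inner_self_eq_zero ?_
      have h (i) : g.inner x (e i x) (∑ j, c j • e j x) = 0 := by
        rw [← hAv, hAc, Pi.zero_apply]
      have h' (u) : g.inner x (∑ j, c j • e j x) u = ∑ j, c j * g.inner x (e j x) u := by simp
      rw [h', Finset.sum_eq_zero fun j _ ↦ by rw [h, mul_zero]]
    simp only [heb] at this
    exact hc (funext fun i ↦ Fintype.linearIndependent_iff.1 b.linearIndependent c this i)
  have hdet_smooth := contMDiffAt_det hA
  -- Cramer's rule solves A c = β for the coefficients of Z in the frame. They are quotients of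
  -- determinants with smooth entries, hence smooth at x.
  let β (y : M) (i : Fin (Module.finrank ℝ E)) : ℝ := g.inner y (Z y) (e i y)
  let c (y : M) (i : Fin (Module.finrank ℝ E)) : ℝ := ((A y).det)⁻¹ * (A y).cramer (β y) i
  have hc (i) : ContMDiffAt 𝓘(ℝ, E) 𝓘(ℝ, ℝ) ∞ (fun y ↦ c y i) x := by
    refine ContMDiffAt.mul (hdet_smooth.inv₀ hdet) ?_
    simp only [Matrix.cramer_apply]
    refine contMDiffAt_det fun j k ↦ ?_
    by_cases hki : k = i
    · subst hki
      simpa using hZ (e j) (he j) x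
    · simpa [Matrix.updateCol_ne hki] using hA j k
  have hsmooth : CMDiffAt ∞ (T% fun y ↦ ∑ i, c y i • e i y) x :=
    .sum_section fun i _ ↦ (hc i).smul_section (he i x)
  refine hsmooth.congr_of_eventuallyEq ?_
  -- Near x the determinant stays nonzero, so the e_i still form a basis, and Z and the combination
  -- have the same inner products with it.
  filter_upwards [hdet_smooth.continuousAt.eventually_ne hdet] with y hy
  congr 1
  have hli : LinearIndependent ℝ fun i ↦ e i y := by
    refine Fintype.linearIndependent_iff.2 fun a ha ↦ congrFun ?_
    refine Matrix.eq_zero_of_mulVec_eq_zero hy (funext fun i ↦ ?_)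
    rw [hAv, ha, map_zero, Pi.zero_apply]
  have hspan := hli.span_eq_top_of_card_eq_finrank' (by simp; rfl)
  have hAc : (A y).mulVec (c y) = β y := by
    have : c y = ((A y).det)⁻¹ • (A y).cramer (β y) := rfl
    rw [this, Matrix.mulVec_smul, Matrix.mulVec_cramer, smul_smul, inv_mul_cancel₀ hy, one_smul]
  refine g.ext_inner fun u ↦ ?_
  have hu : u ∈ Submodule.span ℝ (Set.range fun i ↦ e i y) := hspan ▸ Submodule.mem_top
  induction hu using Submodule.span_induction with
  | mem u hu =>
    obtain ⟨i, rfl⟩ := hu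
    rw [g.symm y _ (e i y), g.symm y _ (e i y), ← hAv, hAc, g.symm y (e i y)]
  | zero => simp
  | add u v _ _ hu hv => rw [map_add, map_add, hu, hv]
  | smul a u _ hu => rw [map_smul, map_smul, hu]

theorem smooth_koszul (g : Metric E M) {X Y Z : Π x : M, TangentSpace 𝓘(ℝ, E) x}
    (hX : CMDiff ∞ (T% X)) (hY : CMDiff ∞ (T% Y)) (hZ : CMDiff ∞ (T% Z)) :
    ContMDiff 𝓘(ℝ, E) 𝓘(ℝ, ℝ) ∞ fun x ↦ koszul g Y x X Z := by
  have s {X Y : Π x : M, TangentSpace 𝓘(ℝ, E) x} (hX : CMDiff ∞ (T% X)) (hY : CMDiff ∞ (T% Y)) :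
      ContMDiff 𝓘(ℝ, E) 𝓘(ℝ, ℝ) ∞ fun y ↦ g.inner y (X y) (Y y) := fun x ↦ g.smooth (hX x) (hY x)
  exact contMDiff_const.mul ((((((smooth_mvfderiv (s hY hZ) hX).add
    (smooth_mvfderiv (s hX hZ) hY)).sub (smooth_mvfderiv (s hX hY) hZ)).add
    (s (smooth_mlieBracket hX hY) hZ)).sub (s (smooth_mlieBracket hY hZ) hX)).sub
    (s (smooth_mlieBracket hX hZ) hY))

/-- The inner products of ∇_X Y with smooth fields are Koszul expressions, which are smooth. -/
theorem smooth_leviCivita [T2Space M] (g : Metric E M) {X Y : Π x : M, TangentSpace 𝓘(ℝ, E) x}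
    (hX : CMDiff ∞ (T% X)) (hY : CMDiff ∞ (T% Y)) :
    CMDiff ∞ (T% fun x ↦ leviCivita g Y x (X x)) := by
  refine g.smooth_of_inner fun W hW ↦ (smooth_koszul g hX hY hW).congr fun x ↦ ?_
  exact inner_lcFun g (hX.mdifferentiable (by simp) x) (hY.mdifferentiable (by simp) x)
    (hW.mdifferentiable (by simp) x)

theorem smooth_sharp_contract [T2Space M] (g : Metric E M) {H : DForm E M 3} (hH : SmoothForm H)
    {X Y : Π x : M, TangentSpace 𝓘(ℝ, E) x} (hX : CMDiff ∞ (T% X)) (hY : CMDiff ∞ (T% Y)) :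
    CMDiff ∞ (T% fun x ↦ g.sharp x (contract H x (X x) (Y x))) := by
  refine g.smooth_of_inner fun W hW ↦ (hH.smooth_three hX hY hW).congr fun x ↦ ?_
  rw [g.inner_sharp, contract_apply]

end Smoothness

/-! ### The calculus of smooth vector fields on a Riemannian manifold -/

section Calculus

variable (E : Type*) [NormedAddCommGroup E] [NormedSpace ℝ E]
  (M : Type*) [TopologicalSpace M] [ChartedSpace E M] [IsManifold 𝓘(ℝ, E) ∞ M]

/-- The space of smooth vector fields. -/
def smoothFields : Submodule ℝ (Π x : M, TangentSpace 𝓘(ℝ, E) x) where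
  carrier := {X | CMDiff ∞ (T% X)}
  add_mem' hX hY := ContMDiff.add_section hX hY
  zero_mem' := contMDiff_zeroSection ℝ (fun x : M ↦ TangentSpace 𝓘(ℝ, E) x)
  smul_mem' a _ hX := ContMDiff.const_smul_section (a := a) hX

/-- The space of smooth functions. -/
def smoothFunctions : Submodule ℝ (M → ℝ) where
  carrier := {f | ContMDiff 𝓘(ℝ, E) 𝓘(ℝ, ℝ) ∞ f}
  add_mem' hf hf' := ContMDiff.add hf hf'
  zero_mem' := contMDiff_const
  smul_mem' _ _ hf := contMDiff_const.mul hf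

variable {E M}

theorem smoothFields_mdiff (X : smoothFields E M) (x : M) : MDiffAt (T% X.1) x :=
  ContMDiff.mdifferentiable X.2 (by simp) x

theorem smoothFunctions_mdiff (f : smoothFunctions E M) (x : M) : MDiffAt f.1 x :=
  ContMDiff.mdifferentiable f.2 (by simp) x

variable [FiniteDimensional ℝ E]

theorem Metric.smooth' (g : Metric E M) {X Y : Π x : M, TangentSpace 𝓘(ℝ, E) x}
    (hX : CMDiff ∞ (T% X)) (hY : CMDiff ∞ (T% Y)) :
    ContMDiff 𝓘(ℝ, E) 𝓘(ℝ, ℝ) ∞ fun y ↦ g.inner y (X y) (Y y) := fun x ↦ g.smooth (hX x) (hY x)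

theorem mvfderiv_const_smul {f : M → ℝ} {x : M} (hf : MDiffAt f x) (a : ℝ) :
    d% (a • f) x = a • d% f x := by
  have h := mvfderiv_smul (a := fun _ : M ↦ a) mdifferentiableAt_const hf
  rw [mvfderiv_const] at h
  ext v
  have h' := congrArg (fun L ↦ L v) h
  have e : (fun _ : M ↦ a) • f = a • f := rfl
  rw [e] at h'
  simpa using h'

/-- The Levi-Civita calculus of a Riemannian manifold. -/
def fieldCalculus [T2Space M] (g : Metric E M) :
    FieldCalculus (smoothFields E M) (smoothFunctions E M) where
  D := LinearMap.mk₂ ℝ (fun X f ↦ ⟨fun x ↦ d% f.1 x (X.1 x), smooth_mvfderiv f.2 X.2⟩)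
    (fun X X' f ↦ Subtype.ext (funext fun x ↦ map_add _ _ _))
    (fun a X f ↦ Subtype.ext (funext fun x ↦ map_smul _ _ _))
    (fun X f f' ↦ Subtype.ext (funext fun x ↦
      congrArg (fun L ↦ L (X.1 x)) (mvfderiv_add (smoothFunctions_mdiff f x) (smoothFunctions_mdiff f' x))))
    (fun a X f ↦ Subtype.ext (funext fun x ↦
      congrArg (fun L ↦ L (X.1 x)) (mvfderiv_const_smul (smoothFunctions_mdiff f x) a)))
  br := LinearMap.mk₂ ℝ (fun X Y ↦ ⟨mlieBracket 𝓘(ℝ, E) X.1 Y.1, smooth_mlieBracket X.2 Y.2⟩)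
    (fun X X' Y ↦ Subtype.ext (funext fun x ↦ mlieBracket_add_left (smoothFields_mdiff X x) (smoothFields_mdiff X' x)))
    (fun a X Y ↦ Subtype.ext (funext fun x ↦ mlieBracket_const_smul_left (smoothFields_mdiff X x)))
    (fun X Y Y' ↦ Subtype.ext (funext fun x ↦ mlieBracket_add_right (smoothFields_mdiff Y x) (smoothFields_mdiff Y' x)))
    (fun a X Y ↦ Subtype.ext (funext fun x ↦ mlieBracket_const_smul_right (smoothFields_mdiff Y x)))
  g := LinearMap.mk₂ ℝ (fun X Y ↦ ⟨fun x ↦ g.inner x (X.1 x) (Y.1 x), g.smooth' X.2 Y.2⟩)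
    (fun X X' Y ↦ Subtype.ext (funext fun x ↦ by simp))
    (fun a X Y ↦ Subtype.ext (funext fun x ↦ by simp))
    (fun X Y Y' ↦ Subtype.ext (funext fun x ↦ by simp))
    (fun a X Y ↦ Subtype.ext (funext fun x ↦ by simp))
  nab := LinearMap.mk₂ ℝ
    (fun X Y ↦ ⟨fun x ↦ leviCivita g Y.1 x (X.1 x), smooth_leviCivita g X.2 Y.2⟩)
    (fun X X' Y ↦ Subtype.ext (funext fun x ↦ map_add _ _ _))
    (fun a X Y ↦ Subtype.ext (funext fun x ↦ map_smul _ _ _))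
    (fun X Y Y' ↦ Subtype.ext (funext fun x ↦ congrArg (fun L ↦ L (X.1 x))
      ((leviCivita g).isCovariantDerivativeOnUniv.add (smoothFields_mdiff Y x) (smoothFields_mdiff Y' x))))
    (fun a X Y ↦ Subtype.ext (funext fun x ↦ congrArg (fun L ↦ L (X.1 x))
      ((leviCivita g).isCovariantDerivativeOnUniv.smul_const a (smoothFields_mdiff Y x))))
  D_br X Y f := Subtype.ext (funext fun x ↦ mvfderiv_mlieBracket f.2 X.2 Y.2 x)
  jacobi X Y Z := by
    have : IsManifold 𝓘(ℝ, E) (minSmoothness ℝ 3) M :=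
      IsManifold.of_le (n := ∞) (by rw [minSmoothness_of_isRCLikeNormedField]; exact WithTop.coe_le_coe.2 le_top)
    have h2 : minSmoothness ℝ 2 ≤ (∞ : WithTop ℕ∞) := by simpa using two_le_infty
    refine Subtype.ext ?_
    exact leibniz_identity_mlieBracket (ContMDiff.of_le X.2 h2) (ContMDiff.of_le Y.2 h2)
      (ContMDiff.of_le Z.2 h2)
  g_symm X Y := Subtype.ext (funext fun x ↦ g.symm x _ _)
  g_ext X Y h := Subtype.ext (funext fun x ↦ g.ext_inner fun u ↦ by
    obtain ⟨W, hW, rfl⟩ := exists_smooth_apply_eq x u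
    exact congrFun (congrArg Subtype.val (h ⟨W, hW⟩)) x)
  torsion X Y := Subtype.ext (funext fun x ↦
    ((CovariantDerivative.torsion_eq_zero_iff _).1 (leviCivita_torsion g) (smoothFields_mdiff X x)
      (smoothFields_mdiff Y x)).symm)
  metric X Y Z := Subtype.ext (funext fun x ↦
    leviCivita_metric g (smoothFields_mdiff X x) (smoothFields_mdiff Y x) (smoothFields_mdiff Z x))

end Calculus

/-! ### The Bismut connections of a generalized Kähler structure -/

section Bismut

variable {E : Type*} [NormedAddCommGroup E] [NormedSpace ℝ E]
  {M : Type*} [TopologicalSpace M] [ChartedSpace E M] [IsManifold 𝓘(ℝ, E) ∞ M]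
  [FiniteDimensional ℝ E]

/-- Scaling by a constant commutes with the exterior derivative without any differentiability, so no
regularity of α is required. -/
theorem extD_neg {k : ℕ} (α : DForm E M k) : extD (-α) = -extD α := by
  funext x
  have h : (coordForm (-α) x) = (-1 : ℝ) • coordForm α x := by
    funext e
    ext v
    have : coordForm (-α) x e v = -coordForm α x e v := rfl
    simpa using this
  refine ContinuousAlternatingMap.ext fun v ↦ ?_
  have h1 := extD_apply (-α) x v
  have h2 := extD_apply α x v
  have h3 : extDeriv (coordForm (-α) x) (extChartAt 𝓘(ℝ, E) x x)
      = (-1 : ℝ) • extDeriv (coordForm α x) (extChartAt 𝓘(ℝ, E) x x) := by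
    rw [h, extDeriv_smul]
  have h4 : extDeriv (coordForm (-α) x) (extChartAt 𝓘(ℝ, E) x x) v
      = -extDeriv (coordForm α x) (extChartAt 𝓘(ℝ, E) x x) v := by
    rw [h3]
    exact neg_one_smul ℝ _
  exact h1.trans (h4.trans (congrArg Neg.neg h2.symm))

theorem extD_zero {k : ℕ} : extD (0 : DForm E M k) = 0 := by
  have h := extD_neg (0 : DForm E M k)
  rw [neg_zero] at h
  funext x
  refine ContinuousAlternatingMap.ext fun v ↦ ?_
  have h' : extD (0 : DForm E M k) x v = -extD (0 : DForm E M k) x v :=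
    congrArg (fun β : DForm E M (k + 1) ↦ β x v) h
  exact self_eq_neg.1 h'

theorem jStar_three (J : Π x : M, TangentSpace 𝓘(ℝ, E) x →L[ℝ] TangentSpace 𝓘(ℝ, E) x)
    (α : DForm E M 3) (x : M) (a b c : TangentSpace 𝓘(ℝ, E) x) :
    jStar J α x ![a, b, c] = α x ![J x a, b, c] + α x ![a, J x b, c] + α x ![a, b, J x c] := by
  have u0 (p : TangentSpace 𝓘(ℝ, E) x) : Function.update ![a, b, c] 0 p = ![p, b, c] := by
    funext i; fin_cases i <;> rfl
  have u1 (p : TangentSpace 𝓘(ℝ, E) x) : Function.update ![a, b, c] 1 p = ![a, p, c] := by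
    funext i; fin_cases i <;> rfl
  have u2 (p : TangentSpace 𝓘(ℝ, E) x) : Function.update ![a, b, c] 2 p = ![a, b, p] := by
    funext i; fin_cases i <;> rfl
  have h : jStar J α x ![a, b, c]
      = ∑ i, α x (Function.update ![a, b, c] i (J x (![a, b, c] i))) := rfl
  rw [h, Fin.sum_univ_three, u0, u1, u2]
  rfl

/-! ### The form -d^cω of a Hermitian structure. -/

namespace HermitianStructure

variable {g : Metric E M} (S : HermitianStructure g)

/-- The form ω has type (1,1): ω(JX,Y) + ω(X,JY) = g(J²X,Y) + g(JX,JY) = 0. -/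
theorem jStar_omega : jStar S.J S.omega = 0 := by
  funext x
  refine ContinuousAlternatingMap.ext fun v ↦ ?_
  have h : jStar S.J S.omega x v = ∑ i, S.omega x (Function.update v i (S.J x (v i))) := rfl
  have h0 : S.omega x (Function.update v 0 (S.J x (v 0))) = g.inner x (S.J x (S.J x (v 0))) (v 1) :=
    rfl
  have h1 : S.omega x (Function.update v 1 (S.J x (v 1))) = g.inner x (S.J x (v 0)) (S.J x (v 1)) :=
    rfl
  refine h.trans ?_
  rw [Fin.sum_univ_two, h0, h1, S.sq, S.hermitian]
  simp

/-- Only one term of the commutator survives. This puts H into the form dω(J·,·,·) + dω(·,J·,·) +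
dω(·,·,J·) that `bismut_parallel` asks for. -/
theorem neg_dc_omega : -dc S.J S.omega = jStar S.J (extD S.omega) := by
  rw [dc, jStar_omega, extD_zero, zero_sub, neg_neg]

theorem smoothForm_omega : SmoothForm S.omega := fun _ hX ↦
  g.smooth' (S.smooth_apply (hX 0)) (hX 1)

theorem smoothForm_extD_omega [T2Space M] : SmoothForm (extD S.omega) := by
  intro X hX
  have hω := S.smoothForm_omega
  have e : (fun x ↦ extD S.omega x fun i ↦ X i x)
      = fun x ↦ extD S.omega x ![X 0 x, X 1 x, X 2 x] :=
    funext fun x ↦ congrArg (extD S.omega x) (eq_vec_three _)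
  rw [e]
  refine ContMDiff.congr ?_ fun x ↦ hω.extD_two (hX 0) (hX 1) (hX 2) x
  exact (((((smooth_mvfderiv (hω.smooth_two (hX 1) (hX 2)) (hX 0)).sub
    (smooth_mvfderiv (hω.smooth_two (hX 0) (hX 2)) (hX 1))).add
    (smooth_mvfderiv (hω.smooth_two (hX 0) (hX 1)) (hX 2))).sub
    (hω.smooth_two (smooth_mlieBracket (hX 0) (hX 1)) (hX 2))).add
    (hω.smooth_two (smooth_mlieBracket (hX 0) (hX 2)) (hX 1))).sub
    (hω.smooth_two (smooth_mlieBracket (hX 1) (hX 2)) (hX 0))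

theorem smoothForm_dc_omega [T2Space M] : SmoothForm (-dc S.J S.omega) := by
  rw [neg_dc_omega]
  intro X hX
  have h := S.smoothForm_extD_omega
  have e : (fun x ↦ jStar S.J (extD S.omega) x fun i ↦ X i x)
      = fun x ↦ jStar S.J (extD S.omega) x ![X 0 x, X 1 x, X 2 x] :=
    funext fun x ↦ congrArg (jStar S.J (extD S.omega) x) (eq_vec_three _)
  rw [e]
  refine ContMDiff.congr ?_ fun x ↦ jStar_three S.J (extD S.omega) x _ _ _
  exact ((h.smooth_three (S.smooth_apply (hX 0)) (hX 1) (hX 2)).add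
    (h.smooth_three (hX 0) (S.smooth_apply (hX 1)) (hX 2))).add
    (h.smooth_three (hX 0) (hX 1) (S.smooth_apply (hX 2)))

/-- The action of the complex structure on smooth vector fields. -/
def fieldMap : smoothFields E M →ₗ[ℝ] smoothFields E M where
  toFun X := ⟨fun x ↦ S.J x (X.1 x), S.smooth_apply X.2⟩
  map_add' _ _ := Subtype.ext (funext fun x ↦ map_add (S.J x) _ _)
  map_smul' _ _ := Subtype.ext (funext fun x ↦ map_smul (S.J x) _ _)

end HermitianStructure

/-! ### Exchange of J₊ and J₋, parallel complex structures and curvature. -/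

namespace GKStructure

variable (𝒢 : GKStructure E M)

/-- The generalized Kähler structure with `J₊` and `J₋` exchanged. -/
def swap : GKStructure E M where
  g := 𝒢.g
  plus := 𝒢.minus
  minus := 𝒢.plus
  dc_add := (add_comm (dc 𝒢.minus.J 𝒢.minus.omega) _).trans 𝒢.dc_add
  ddc := by
    rw [← neg_eq_of_add_eq_zero_right 𝒢.dc_add, extD_neg, 𝒢.ddc, neg_zero]

/-- This is the condition d^c₊ω₊ + d^c₋ω₋ = 0. It makes ∇⁻ the plus connection of the exchanged
structure, so only ∇⁺ has to be studied. -/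
theorem swap_H : 𝒢.swap.H = -𝒢.H := by
  rw [H, H, neg_neg]
  exact neg_eq_of_add_eq_zero_left 𝒢.dc_add

theorem contract_neg (H : DForm E M 3) (x : M) (v w : TangentSpace 𝓘(ℝ, E) x) :
    contract (-H) x v w = -contract H x v w := rfl

theorem swap_nablaPlus_apply (Y : Π x : M, TangentSpace 𝓘(ℝ, E) x) (x : M)
    (v : TangentSpace 𝓘(ℝ, E) x) : 𝒢.swap.nablaPlus Y x v = 𝒢.nablaMinus Y x v := by
  rw [nablaPlus_apply, nablaMinus_apply, swap_H, contract_neg, map_neg, smul_neg, neg_smul]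
  rfl

theorem swap_nablaPlus : 𝒢.swap.nablaPlus = 𝒢.nablaMinus := by
  apply CovariantDerivative.ext
  funext Y x
  exact ContinuousLinearMap.ext (𝒢.swap_nablaPlus_apply Y x)

variable [T2Space M]

theorem smoothForm_H : SmoothForm 𝒢.H := 𝒢.plus.smoothForm_dc_omega

/-- The operator `½ g⁻¹H` on smooth vector fields. -/
def torsionMap : smoothFields E M →ₗ[ℝ] smoothFields E M →ₗ[ℝ] smoothFields E M :=
  LinearMap.mk₂ ℝ
    (fun X Y ↦ (1 / 2 : ℝ) • ⟨fun x ↦ 𝒢.g.sharp x (contract 𝒢.H x (X.1 x) (Y.1 x)),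
      smooth_sharp_contract 𝒢.g 𝒢.smoothForm_H X.2 Y.2⟩)
    (fun X X' Y ↦ Subtype.ext (funext fun x ↦ by simp))
    (fun a X Y ↦ Subtype.ext (funext fun x ↦ by simp [smul_comm a]))
    (fun X Y Y' ↦ Subtype.ext (funext fun x ↦ by simp))
    (fun a X Y ↦ Subtype.ext (funext fun x ↦ by simp [smul_comm a]))

/-- The `3`-form `½ H` on smooth vector fields. -/
def torsionForm (X Y Z : smoothFields E M) : smoothFunctions E M :=
  (1 / 2 : ℝ) • ⟨fun x ↦ 𝒢.H x ![X.1 x, Y.1 x, Z.1 x], 𝒢.smoothForm_H.smooth_three X.2 Y.2 Z.2⟩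

theorem nab_sub_torsionMap (X Y : smoothFields E M) (x : M) :
    ((fieldCalculus 𝒢.g).nab X Y - 𝒢.torsionMap X Y).1 x = 𝒢.nablaMinus Y.1 x (X.1 x) := by
  rw [nablaMinus_apply, neg_smul, ← sub_eq_add_neg]
  rfl

theorem g_torsionMap (X Y Z : smoothFields E M) :
    (fieldCalculus 𝒢.g).g (𝒢.torsionMap X Y) Z = 𝒢.torsionForm X Y Z := by
  refine Subtype.ext (funext fun x ↦ ?_)
  have h : ((fieldCalculus 𝒢.g).g (𝒢.torsionMap X Y) Z).1 x
      = 𝒢.g.inner x ((1 / 2 : ℝ) • 𝒢.g.sharp x (contract 𝒢.H x (X.1 x) (Y.1 x))) (Z.1 x) := rfl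
  rw [h, map_smul, smul_apply, Metric.inner_sharp, contract_apply]
  rfl

theorem H_swap_left (x : M) (a b c : TangentSpace 𝓘(ℝ, E) x) :
    𝒢.H x ![a, b, c] = -𝒢.H x ![b, a, c] := by
  have h := (𝒢.H x).map_swap ![b, a, c] (i := 0) (j := 1) (by decide)
  refine Eq.trans ?_ h
  exact congrArg (𝒢.H x) (by funext i; fin_cases i <;> rfl)

theorem H_swap_right (x : M) (a b c : TangentSpace 𝓘(ℝ, E) x) :
    𝒢.H x ![a, b, c] = -𝒢.H x ![a, c, b] := by
  have h := (𝒢.H x).map_swap ![a, c, b] (i := 1) (j := 2) (by decide)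
  refine Eq.trans ?_ h
  exact congrArg (𝒢.H x) (by funext i; fin_cases i <;> rfl)

theorem extD_H : extD 𝒢.H = 0 := by
  rw [H, extD_neg, 𝒢.ddc, neg_zero]

/-- By the invariant formula this is ½dH, and dH = -dd^c₊ω₊ = 0. -/
theorem dThree_torsionForm (X Y Z W : smoothFields E M) :
    (fieldCalculus 𝒢.g).dThree 𝒢.torsionForm X Y Z W = 0 := by
  let h₁ (X Y Z : smoothFields E M) : smoothFunctions E M :=
    ⟨fun x ↦ 𝒢.H x ![X.1 x, Y.1 x, Z.1 x], 𝒢.smoothForm_H.smooth_three X.2 Y.2 Z.2⟩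
  have h₂ (X Y Z : smoothFields E M) : 𝒢.torsionForm X Y Z = (1 / 2 : ℝ) • h₁ X Y Z := rfl
  have h₃ : (fieldCalculus 𝒢.g).dThree h₁ X Y Z W = 0 := by
    refine Subtype.ext (funext fun x ↦ ?_)
    have h := 𝒢.smoothForm_H.extD_three X.2 Y.2 Z.2 W.2 x
    rw [extD_H] at h
    exact h.symm
  have h₄ : (fieldCalculus 𝒢.g).dThree 𝒢.torsionForm X Y Z W
      = (1 / 2 : ℝ) • (fieldCalculus 𝒢.g).dThree h₁ X Y Z W := by
    simp only [FieldCalculus.dThree, h₂, map_smul]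
    module
  rw [h₄, h₃, smul_zero]

/-- Here h = ½H, so the hypothesis on 2h in `bismut_parallel` reads H = J₊*dω₊. -/
theorem nab_add_torsionMap_fieldMap (X Y : smoothFields E M) :
    ((fieldCalculus 𝒢.g).nab + 𝒢.torsionMap) X (𝒢.plus.fieldMap Y)
      = 𝒢.plus.fieldMap (((fieldCalculus 𝒢.g).nab + 𝒢.torsionMap) X Y) := by
  refine (fieldCalculus 𝒢.g).bismut_parallel 𝒢.plus.fieldMap
    (fun X ↦ Subtype.ext (funext fun x ↦ 𝒢.plus.sq x _))
    (fun X Y ↦ Subtype.ext (funext fun x ↦ 𝒢.plus.hermitian x _ _))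
    (fun X Y ↦ Subtype.ext (funext fun x ↦ 𝒢.plus.integrable X.1 Y.1 X.2 Y.2 x))
    𝒢.torsionForm 𝒢.torsionMap 𝒢.g_torsionMap (fun X Y Z ↦ ?_) X Y
  refine Subtype.ext (funext fun x ↦ ?_)
  have h : ((2 : ℝ) • 𝒢.torsionForm X Y Z).1 x = 𝒢.H x ![X.1 x, Y.1 x, Z.1 x] := by
    rw [torsionForm, smul_smul, mul_one_div_cancel (two_ne_zero), one_smul]
  have hω := 𝒢.plus.smoothForm_omega
  rw [h, H, 𝒢.plus.neg_dc_omega, jStar_three]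
  have e1 := hω.extD_two (𝒢.plus.fieldMap X).2 Y.2 Z.2 x
  have e2 := hω.extD_two X.2 (𝒢.plus.fieldMap Y).2 Z.2 x
  have e3 := hω.extD_two X.2 Y.2 (𝒢.plus.fieldMap Z).2 x
  exact congrArg₂ (· + ·) (congrArg₂ (· + ·) e1 e2) e3

theorem nablaPlus_J {Y : Π x : M, TangentSpace 𝓘(ℝ, E) x} (hY : CMDiff ∞ (T% Y)) (x : M)
    (v : TangentSpace 𝓘(ℝ, E) x) :
    𝒢.nablaPlus (fun y ↦ 𝒢.Jp y (Y y)) x v = 𝒢.Jp x (𝒢.nablaPlus Y x v) := by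
  obtain ⟨X, hX, rfl⟩ := exists_smooth_apply_eq x v
  exact congrFun (congrArg Subtype.val (𝒢.nab_add_torsionMap_fieldMap ⟨X, hX⟩ ⟨Y, hY⟩)) x

theorem nablaMinus_J {Y : Π x : M, TangentSpace 𝓘(ℝ, E) x} (hY : CMDiff ∞ (T% Y)) (x : M)
    (v : TangentSpace 𝓘(ℝ, E) x) :
    𝒢.nablaMinus (fun y ↦ 𝒢.Jm y (Y y)) x v = 𝒢.Jm x (𝒢.nablaMinus Y x v) := by
  have h := 𝒢.swap.nablaPlus_J hY x v
  rw [swap_nablaPlus_apply, swap_nablaPlus_apply] at h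
  exact h

/-- The abstract result applies with J = J₋, because ∇ - B = ∇⁻ preserves J₋ and ½H is closed and
totally skew. -/
theorem curvature_nablaPlus_J {X Y Z : Π x : M, TangentSpace 𝓘(ℝ, E) x} (hX : CMDiff ∞ (T% X))
    (hY : CMDiff ∞ (T% Y)) (hZ : CMDiff ∞ (T% Z)) (x : M) :
    curvature 𝒢.nablaPlus (fun y ↦ 𝒢.Jm y (X y)) (fun y ↦ 𝒢.Jm y (Y y)) Z x
      = curvature 𝒢.nablaPlus X Y Z x := by
  have h := (fieldCalculus 𝒢.g).curv_bismut_apply_J 𝒢.minus.fieldMap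
    (fun X Y ↦ Subtype.ext (funext fun x ↦ 𝒢.minus.hermitian x _ _))
    𝒢.torsionForm 𝒢.torsionMap 𝒢.g_torsionMap
    (fun X Y Z ↦ Subtype.ext (funext fun x ↦ by
      have := 𝒢.H_swap_left x (X.1 x) (Y.1 x) (Z.1 x)
      have h' : (1 / 2 : ℝ) * 𝒢.H x ![X.1 x, Y.1 x, Z.1 x]
        = -((1 / 2 : ℝ) * 𝒢.H x ![Y.1 x, X.1 x, Z.1 x]) := by rw [this, mul_neg]
      exact h'))
    (fun X Y Z ↦ Subtype.ext (funext fun x ↦ by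
      have := 𝒢.H_swap_right x (X.1 x) (Y.1 x) (Z.1 x)
      have h' : (1 / 2 : ℝ) * 𝒢.H x ![X.1 x, Y.1 x, Z.1 x]
        = -((1 / 2 : ℝ) * 𝒢.H x ![X.1 x, Z.1 x, Y.1 x]) := by rw [this, mul_neg]
      exact h'))
    𝒢.dThree_torsionForm
    (fun X Y ↦ Subtype.ext (funext fun x ↦
      (𝒢.nab_sub_torsionMap X (𝒢.minus.fieldMap Y) x).trans ((𝒢.nablaMinus_J Y.2 x (X.1 x)).trans
        (congrArg (𝒢.Jm x) (𝒢.nab_sub_torsionMap X Y x).symm))))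
    ⟨X, hX⟩ ⟨Y, hY⟩ ⟨Z, hZ⟩
  exact congrFun (congrArg Subtype.val h) x

/-- The torsion terms cancel because H is skew in its last two arguments. -/
theorem nablaPlus_metric {Y Z : Π x : M, TangentSpace 𝓘(ℝ, E) x} (hY : CMDiff ∞ (T% Y))
    (hZ : CMDiff ∞ (T% Z)) (x : M) (v : TangentSpace 𝓘(ℝ, E) x) :
    d% (fun y ↦ 𝒢.g.inner y (Y y) (Z y)) x v
      = 𝒢.g.inner x (𝒢.nablaPlus Y x v) (Z x) + 𝒢.g.inner x (Y x) (𝒢.nablaPlus Z x v) := by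
  obtain ⟨X, hX, rfl⟩ := exists_smooth_apply_eq x v
  rw [leviCivita_metric 𝒢.g (hX.mdifferentiable (by simp) x) (hY.mdifferentiable (by simp) x)
    (hZ.mdifferentiable (by simp) x), nablaPlus_apply, nablaPlus_apply]
  simp only [map_add, map_smul, add_apply, smul_apply, Metric.inner_sharp]
  rw [𝒢.g.symm x (Y x) (𝒢.g.sharp x _), Metric.inner_sharp, contract_apply, contract_apply,
    𝒢.H_swap_right x (X x) (Z x) (Y x)]
  simp only [smul_eq_mul]
  ring

theorem smooth_nablaPlus {X Y : Π x : M, TangentSpace 𝓘(ℝ, E) x} (hX : CMDiff ∞ (T% X))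
    (hY : CMDiff ∞ (T% Y)) : CMDiff ∞ (T% fun x ↦ 𝒢.nablaPlus Y x (X x)) :=
  (((fieldCalculus 𝒢.g).nab + 𝒢.torsionMap) ⟨X, hX⟩ ⟨Y, hY⟩).2

end GKStructure

end Bismut

/-! ### Complexified vectors and operators -/

section Complexification

variable {E : Type*} [NormedAddCommGroup E] [NormedSpace ℝ E]
  {M : Type*} [TopologicalSpace M] [ChartedSpace E M]

theorem mkC_reC_imC {x : M} (z : CTan E x) : mkC (reC x z) (imC x z) = z := by
  induction z using TensorProduct.induction_on with
  | zero => simp [mkC]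
  | tmul c v =>
    have h1 : reC x (c ⊗ₜ[ℝ] v) = c.re • v := by simp [reC]
    have h2 : imC x (c ⊗ₜ[ℝ] v) = c.im • v := by simp [imC]
    rw [h1, h2, mkC, ← TensorProduct.smul_tmul, ← TensorProduct.smul_tmul, ← TensorProduct.add_tmul]
    congr 1
    apply Complex.ext <;> simp
  | add z w hz hw =>
    refine Eq.trans ?_ (congrArg₂ (· + ·) hz hw)
    simp only [mkC, map_add, TensorProduct.tmul_add]
    abel

theorem ext_reC_imC {x : M} {z w : CTan E x} (hr : reC x z = reC x w) (hi : imC x z = imC x w) :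
    z = w := by
  rw [← mkC_reC_imC z, ← mkC_reC_imC w, hr, hi]

theorem reC_I_smul {x : M} (z : CTan E x) : reC x (Complex.I • z) = -imC x z := by
  induction z using TensorProduct.induction_on with
  | zero => simp
  | tmul c v => simp [reC, imC, TensorProduct.smul_tmul']
  | add z w hz hw => rw [smul_add, map_add, map_add, hz, hw, neg_add]

theorem imC_I_smul {x : M} (z : CTan E x) : imC x (Complex.I • z) = reC x z := by
  induction z using TensorProduct.induction_on with
  | zero => simp
  | tmul c v => simp [reC, imC, TensorProduct.smul_tmul']
  | add z w hz hw => rw [smul_add, map_add, map_add, hz, hw]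

theorem smul_eq_re_add_im {x : M} (c : ℂ) (z : CTan E x) :
    c • z = c.re • z + c.im • (Complex.I • z) := by
  conv_lhs => rw [← Complex.re_add_im c, add_smul, mul_smul]
  rfl

theorem reC_smul {x : M} (c : ℂ) (z : CTan E x) :
    reC x (c • z) = c.re • reC x z - c.im • imC x z := by
  rw [smul_eq_re_add_im, map_add, map_smul, map_smul, reC_I_smul, smul_neg, sub_eq_add_neg]

theorem imC_smul {x : M} (c : ℂ) (z : CTan E x) :
    imC x (c • z) = c.re • imC x z + c.im • reC x z := by
  rw [smul_eq_re_add_im, map_add, map_smul, map_smul, imC_I_smul]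

theorem reC_baseChange {x : M} (A : TangentSpace 𝓘(ℝ, E) x →ₗ[ℝ] TangentSpace 𝓘(ℝ, E) x)
    (z : CTan E x) : reC x (LinearMap.baseChange ℂ A z) = A (reC x z) := by
  induction z using TensorProduct.induction_on with
  | zero => simp
  | tmul c v => simp [reC]
  | add z w hz hw => simp only [map_add, hz, hw]

theorem imC_baseChange {x : M} (A : TangentSpace 𝓘(ℝ, E) x →ₗ[ℝ] TangentSpace 𝓘(ℝ, E) x)
    (z : CTan E x) : imC x (LinearMap.baseChange ℂ A z) = A (imC x z) := by
  induction z using TensorProduct.induction_on with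
  | zero => simp
  | tmul c v => simp [imC]
  | add z w hz hw => simp only [map_add, hz, hw]

variable {J : Π x : M, TangentSpace 𝓘(ℝ, E) x →L[ℝ] TangentSpace 𝓘(ℝ, E) x}

theorem mem_T10_iff {x : M} {z : CTan E x} :
    z ∈ T10 J x ↔ J x (reC x z) = -imC x z ∧ J x (imC x z) = reC x z := by
  rw [T10, Module.End.mem_eigenspace_iff]
  constructor
  · intro h
    have hr := congrArg (reC x) h
    have hi := congrArg (imC x) h
    rw [reC_baseChange, reC_I_smul] at hr
    rw [imC_baseChange, imC_I_smul] at hi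
    exact ⟨hr, hi⟩
  · rintro ⟨hr, hi⟩
    apply ext_reC_imC
    · rw [reC_baseChange, reC_I_smul]; exact hr
    · rw [imC_baseChange, imC_I_smul]; exact hi

theorem mem_T01_iff {x : M} {z : CTan E x} :
    z ∈ T01 J x ↔ J x (reC x z) = imC x z ∧ J x (imC x z) = -reC x z := by
  rw [T01, Module.End.mem_eigenspace_iff, neg_smul]
  constructor
  · intro h
    have hr := congrArg (reC x) h
    have hi := congrArg (imC x) h
    rw [reC_baseChange, map_neg, reC_I_smul, neg_neg] at hr
    rw [imC_baseChange, map_neg, imC_I_smul] at hi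
    exact ⟨hr, hi⟩
  · rintro ⟨hr, hi⟩
    apply ext_reC_imC
    · rw [reC_baseChange, map_neg, reC_I_smul, neg_neg]; exact hr
    · rw [imC_baseChange, map_neg, imC_I_smul]; exact hi

theorem proj01_of_mem_T10 {x : M} {z : CTan E x} (hz : z ∈ T10 J x) : proj01 J x z = 0 := by
  rw [T10, Module.End.mem_eigenspace_iff] at hz
  rw [proj01, LinearMap.smul_apply, LinearMap.add_apply, LinearMap.smul_apply, hz, smul_smul,
    Complex.I_mul_I]
  simp

theorem proj01_of_mem_T01 {x : M} {z : CTan E x} (hz : z ∈ T01 J x) : proj01 J x z = z := by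
  rw [T01, Module.End.mem_eigenspace_iff] at hz
  rw [proj01, LinearMap.smul_apply, LinearMap.add_apply, LinearMap.smul_apply, hz, smul_smul,
    mul_neg, Complex.I_mul_I, neg_neg, one_smul, LinearMap.id_apply, ← two_smul ℂ z, smul_smul]
  simp

theorem reC_proj01 {x : M} (z : CTan E x) :
    reC x (proj01 J x z) = (1 / 2 : ℝ) • (reC x z - J x (imC x z)) := by
  have h : ((1 / 2 : ℂ)).re = 1 / 2 ∧ ((1 / 2 : ℂ)).im = 0 := by norm_num
  rw [proj01, LinearMap.smul_apply, reC_smul, h.1, h.2, zero_smul, sub_zero, LinearMap.add_apply,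
    map_add, LinearMap.smul_apply, reC_I_smul, imC_baseChange, sub_eq_add_neg]
  rfl

theorem imC_proj01 {x : M} (z : CTan E x) :
    imC x (proj01 J x z) = (1 / 2 : ℝ) • (imC x z + J x (reC x z)) := by
  have h : ((1 / 2 : ℂ)).re = 1 / 2 ∧ ((1 / 2 : ℂ)).im = 0 := by norm_num
  rw [proj01, LinearMap.smul_apply, imC_smul, h.1, h.2, zero_smul, add_zero, LinearMap.add_apply,
    map_add, LinearMap.smul_apply, imC_I_smul, reC_baseChange]
  rfl

variable [IsManifold 𝓘(ℝ, E) ∞ M] [FiniteDimensional ℝ E]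

theorem dC_apply (f : M → ℂ) (x : M) (w : CTan E x) :
    dC f x w = d% f x (reC x w) + Complex.I * d% f x (imC x w) := by
  conv_lhs => rw [← mkC_reC_imC w]
  simp [dC, mkC]

/-- Complex conjugation on the complexified tangent space. -/
def conjC {x : M} (z : CTan E x) : CTan E x := mkC (reC x z) (-imC x z)

theorem reC_conjC {x : M} (z : CTan E x) : reC x (conjC z) = reC x z := reC_mkC _ _

theorem imC_conjC {x : M} (z : CTan E x) : imC x (conjC z) = -imC x z := imC_mkC _ _

theorem conjC_mem_T01 {x : M} {z : CTan E x} (hz : z ∈ T10 J x) : conjC z ∈ T01 J x := by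
  rw [mem_T10_iff] at hz
  rw [mem_T01_iff, reC_conjC, imC_conjC, map_neg, hz.1, hz.2]
  exact ⟨rfl, rfl⟩

section Connection

variable (D : CovariantDerivative 𝓘(ℝ, E) E (fun x : M ↦ TangentSpace 𝓘(ℝ, E) x))

theorem reC_complexify (s : Π x : M, CTan E x) (x : M) (w : CTan E x) :
    reC x (complexify D s x w) = D (fun y ↦ reC y (s y)) x (reC x w)
      - D (fun y ↦ imC y (s y)) x (imC x w) := by
  rw [complexify, LinearMap.add_apply, map_add, LinearMap.smul_apply, reC_I_smul, reC_baseChange,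
    imC_baseChange, sub_eq_add_neg]
  rfl

theorem imC_complexify (s : Π x : M, CTan E x) (x : M) (w : CTan E x) :
    imC x (complexify D s x w) = D (fun y ↦ reC y (s y)) x (imC x w)
      + D (fun y ↦ imC y (s y)) x (reC x w) := by
  rw [complexify, LinearMap.add_apply, map_add, LinearMap.smul_apply, imC_I_smul, reC_baseChange,
    imC_baseChange]
  rfl

theorem mdiff_of_smooth {X : Π x : M, TangentSpace 𝓘(ℝ, E) x} (hX : CMDiff ∞ (T% X)) (x : M) :
    MDiffAt (T% X) x := hX.mdifferentiable (by simp) x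

theorem covariant_add {X Y : Π x : M, TangentSpace 𝓘(ℝ, E) x} (hX : CMDiff ∞ (T% X))
    (hY : CMDiff ∞ (T% Y)) (x : M) (v : TangentSpace 𝓘(ℝ, E) x) :
    D (fun y ↦ X y + Y y) x v = D X x v + D Y x v :=
  congrArg (fun L ↦ L v)
    (D.isCovariantDerivativeOnUniv.add (mdiff_of_smooth hX x) (mdiff_of_smooth hY x))

theorem covariant_neg {X : Π x : M, TangentSpace 𝓘(ℝ, E) x} (hX : CMDiff ∞ (T% X)) (x : M)
    (v : TangentSpace 𝓘(ℝ, E) x) : D (fun y ↦ -X y) x v = -D X x v := by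
  have h := D.isCovariantDerivativeOnUniv.smul_const (-1) (mdiff_of_smooth hX x)
  have e : (-1 : ℝ) • X = fun y ↦ -X y := funext fun y ↦ neg_one_smul ℝ (X y)
  rw [e] at h
  exact (congrArg (fun L ↦ L v) h).trans (neg_one_smul ℝ _)

theorem covariant_sub {X Y : Π x : M, TangentSpace 𝓘(ℝ, E) x} (hX : CMDiff ∞ (T% X))
    (hY : CMDiff ∞ (T% Y)) (x : M) (v : TangentSpace 𝓘(ℝ, E) x) :
    D (fun y ↦ X y - Y y) x v = D X x v - D Y x v := by
  have hY' : CMDiff ∞ (T% fun y ↦ -Y y) := ContMDiff.neg_section hY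
  have h := covariant_add D hX hY' x v
  rw [covariant_neg D hY, ← sub_eq_add_neg] at h
  rw [← h]
  congr 2
  funext y
  exact sub_eq_add_neg _ _

theorem covariant_smul {f : M → ℝ} {X : Π x : M, TangentSpace 𝓘(ℝ, E) x}
    (hf : ContMDiff 𝓘(ℝ, E) 𝓘(ℝ, ℝ) ∞ f) (hX : CMDiff ∞ (T% X)) (x : M)
    (v : TangentSpace 𝓘(ℝ, E) x) :
    D (fun y ↦ f y • X y) x v = f x • D X x v + d% f x v • X x :=
  congrArg (fun L ↦ L v)
    (D.isCovariantDerivativeOnUniv.leibniz (mdiff_of_smooth hX x) (hf.mdifferentiable (by simp) x))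

end Connection

theorem mvfderiv_clm_comp {F G : Type*} [NormedAddCommGroup F] [NormedSpace ℝ F]
    [NormedAddCommGroup G] [NormedSpace ℝ G] (L : F →L[ℝ] G) {f : M → F} {x : M}
    (hf : MDiffAt f x) (v : TangentSpace 𝓘(ℝ, E) x) :
    d% (fun y ↦ L (f y)) x v = L (d% f x v) := by
  have h := (L.hasMFDerivAt (x := f x)).comp x hf.hasMFDerivAt
  exact congrArg (fun A ↦ A v) h.mfderiv

theorem contMDiff_re {f : M → ℂ} (hf : ContMDiff 𝓘(ℝ, E) 𝓘(ℝ, ℂ) ∞ f) :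
    ContMDiff 𝓘(ℝ, E) 𝓘(ℝ, ℝ) ∞ fun y ↦ (f y).re :=
  Complex.reCLM.contDiff.contMDiff.comp hf

theorem contMDiff_im {f : M → ℂ} (hf : ContMDiff 𝓘(ℝ, E) 𝓘(ℝ, ℂ) ∞ f) :
    ContMDiff 𝓘(ℝ, E) 𝓘(ℝ, ℝ) ∞ fun y ↦ (f y).im :=
  Complex.imCLM.contDiff.contMDiff.comp hf

theorem contMDiff_mk {f g : M → ℝ} (hf : ContMDiff 𝓘(ℝ, E) 𝓘(ℝ, ℝ) ∞ f)
    (hg : ContMDiff 𝓘(ℝ, E) 𝓘(ℝ, ℝ) ∞ g) :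
    ContMDiff 𝓘(ℝ, E) 𝓘(ℝ, ℂ) ∞ fun y ↦ (⟨f y, g y⟩ : ℂ) :=
  Complex.equivRealProdCLM.symm.contDiff.contMDiff.comp (hf.prodMk_space hg)

theorem re_mvfderiv {f : M → ℂ} (hf : ContMDiff 𝓘(ℝ, E) 𝓘(ℝ, ℂ) ∞ f) (x : M)
    (v : TangentSpace 𝓘(ℝ, E) x) : (d% f x v : ℂ).re = d% (fun y ↦ (f y).re) x v :=
  (mvfderiv_clm_comp Complex.reCLM (hf.mdifferentiable (by simp) x) v).symm

theorem im_mvfderiv {f : M → ℂ} (hf : ContMDiff 𝓘(ℝ, E) 𝓘(ℝ, ℂ) ∞ f) (x : M)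
    (v : TangentSpace 𝓘(ℝ, E) x) : (d% f x v : ℂ).im = d% (fun y ↦ (f y).im) x v :=
  (mvfderiv_clm_comp Complex.imCLM (hf.mdifferentiable (by simp) x) v).symm

end Complexification

/-! ### Holomorphic structures and Chern connections -/

section Chern

variable {E : Type*} [NormedAddCommGroup E] [NormedSpace ℝ E]
  {M : Type*} [TopologicalSpace M] [ChartedSpace E M] [IsManifold 𝓘(ℝ, E) ∞ M]
  [FiniteDimensional ℝ E]

theorem IsSmooth.mk {Z : Π x : M, CTan E x} {X Y : Π x : M, TangentSpace 𝓘(ℝ, E) x}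
    (hX : CMDiff ∞ (T% X)) (hY : CMDiff ∞ (T% Y)) (hr : ∀ x, reC x (Z x) = X x)
    (hi : ∀ x, imC x (Z x) = Y x) : IsSmooth Z := by
  obtain rfl : (fun x ↦ reC x (Z x)) = X := funext hr
  obtain rfl : (fun x ↦ imC x (Z x)) = Y := funext hi
  exact ⟨hX, hY⟩

theorem hermForm_self_pos (g : Metric E M) (x : M) {z : CTan E x} (hz : z ≠ 0) :
    0 < (hermForm g x z z).re := by
  have p (v : TangentSpace 𝓘(ℝ, E) x) : 0 ≤ g.inner x v v := by
    by_cases h : v = 0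
    · simp [h]
    · exact (g.pos x v h).le
  change 0 < g.inner x (reC x z) (reC x z) + g.inner x (imC x z) (imC x z)
  by_cases h : reC x z = 0
  · have h' : imC x z ≠ 0 := fun h' ↦ hz (ext_reC_imC (by rw [h, map_zero]) (by rw [h', map_zero]))
    exact add_pos_of_nonneg_of_pos (p _) (g.pos x _ h')
  · exact add_pos_of_pos_of_nonneg (g.pos x _ h) (p _)

theorem hermForm_add_left (g : Metric E M) (x : M) (s t u : CTan E x) :
    hermForm g x (s + t) u = hermForm g x s u + hermForm g x t u := by
  apply Complex.ext <;> simp [hermForm] <;> ring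

theorem hermForm_smul_left (g : Metric E M) (x : M) (c : ℂ) (s t : CTan E x) :
    hermForm g x (c • s) t = c * hermForm g x s t := by
  apply Complex.ext <;> simp [hermForm, reC_smul, imC_smul] <;> ring

theorem hermForm_conj_symm (g : Metric E M) (x : M) (s t : CTan E x) :
    hermForm g x t s = starRingEnd ℂ (hermForm g x s t) := by
  apply Complex.ext
  · simp [hermForm, g.symm x (reC x t), g.symm x (imC x t)]
  · simp [hermForm, g.symm x (imC x t), g.symm x (reC x t)]

theorem smooth_hermForm (g : Metric E M) {s t : Π x : M, CTan E x} (hs : IsSmooth s)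
    (ht : IsSmooth t) : ContMDiff 𝓘(ℝ, E) 𝓘(ℝ, ℂ) ∞ fun x : M ↦ hermForm g x (s x) (t x) :=
  contMDiff_mk ((g.smooth' hs.1 ht.1).add (g.smooth' hs.2 ht.2))
    ((g.smooth' hs.2 ht.1).sub (g.smooth' hs.1 ht.2))

theorem isHermitianMetric_hermForm (g : Metric E M) (V : Π x : M, Submodule ℂ (CTan E x)) :
    IsHermitianMetric V (hermForm g) where
  add_left x s _ t _ u _ := hermForm_add_left g x s t u
  smul_left x c s _ t _ := hermForm_smul_left g x c s t
  conj_symm x s _ t _ := hermForm_conj_symm g x s t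
  pos x _ _ hs := hermForm_self_pos g x hs
  smooth _ _ hs ht := smooth_hermForm g hs.1 ht.1

section Complexify

variable (D : CovariantDerivative 𝓘(ℝ, E) E (fun x : M ↦ TangentSpace 𝓘(ℝ, E) x))

theorem complexify_add {s t : Π x : M, CTan E x} (hs : IsSmooth s) (ht : IsSmooth t) (x : M) :
    complexify D (fun y ↦ s y + t y) x = complexify D s x + complexify D t x := by
  refine LinearMap.ext fun w ↦ ?_
  rw [LinearMap.add_apply]
  apply ext_reC_imC
  · rw [map_add]
    simp only [reC_complexify, map_add]
    rw [covariant_add D hs.1 ht.1, covariant_add D hs.2 ht.2]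
    abel
  · rw [map_add]
    simp only [imC_complexify, map_add]
    rw [covariant_add D hs.1 ht.1, covariant_add D hs.2 ht.2]
    abel

theorem complexify_smul {f : M → ℂ} {s : Π x : M, CTan E x}
    (hf : ContMDiff 𝓘(ℝ, E) 𝓘(ℝ, ℂ) ∞ f) (hs : IsSmooth s) (x : M) (w : CTan E x) :
    complexify D (fun y ↦ f y • s y) x w = dC f x w • s x + f x • complexify D s x w := by
  have h1 := contMDiff_re hf
  have h2 := contMDiff_im hf
  have s1 {f : M → ℝ} {X : Π x : M, TangentSpace 𝓘(ℝ, E) x}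
    (hf : ContMDiff 𝓘(ℝ, E) 𝓘(ℝ, ℝ) ∞ f) (hX : CMDiff ∞ (T% X)) :
      CMDiff ∞ (T% fun y ↦ f y • X y) := ContMDiff.smul_section hf hX
  have hr (v) : D (fun y ↦ reC y (f y • s y)) x v
      = (f x).re • D (fun y ↦ reC y (s y)) x v + d% (fun y ↦ (f y).re) x v • reC x (s x)
        - ((f x).im • D (fun y ↦ imC y (s y)) x v + d% (fun y ↦ (f y).im) x v • imC x (s x)) := by
    simp only [reC_smul]
    rw [covariant_sub D (s1 h1 hs.1) (s1 h2 hs.2), covariant_smul D h1 hs.1, covariant_smul D h2 hs.2]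
  have hi (v) : D (fun y ↦ imC y (f y • s y)) x v
      = (f x).re • D (fun y ↦ imC y (s y)) x v + d% (fun y ↦ (f y).re) x v • imC x (s x)
        + ((f x).im • D (fun y ↦ reC y (s y)) x v + d% (fun y ↦ (f y).im) x v • reC x (s x)) := by
    simp only [imC_smul]
    rw [covariant_add D (s1 h1 hs.2) (s1 h2 hs.1), covariant_smul D h1 hs.2, covariant_smul D h2 hs.1]
  have hd1 : (dC f x w).re = d% (fun y ↦ (f y).re) x (reC x w)
      - d% (fun y ↦ (f y).im) x (imC x w) := by
    rw [dC_apply, Complex.add_re, Complex.I_mul_re, re_mvfderiv hf, im_mvfderiv hf, sub_eq_add_neg]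
  have hd2 : (dC f x w).im = d% (fun y ↦ (f y).im) x (reC x w)
      + d% (fun y ↦ (f y).re) x (imC x w) := by
    rw [dC_apply, Complex.add_im, Complex.I_mul_im, re_mvfderiv hf, im_mvfderiv hf]
  apply ext_reC_imC
  · rw [map_add, reC_smul, reC_smul, reC_complexify, reC_complexify, imC_complexify, hr, hi, hd1, hd2]
    module
  · rw [map_add, imC_smul, imC_smul, imC_complexify, reC_complexify, imC_complexify, hr, hi, hd1, hd2]
    module

theorem curvature_neg_right {X Y Z : Π x : M, TangentSpace 𝓘(ℝ, E) x}
    (hY : CMDiff ∞ (T% Y)) (x : M) (h : CMDiff ∞ (T% fun y ↦ D Z y (Y y))) :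
    curvature D X (fun y ↦ -Y y) Z x = -curvature D X Y Z x := by
  have hb : mlieBracket 𝓘(ℝ, E) X (fun y ↦ -Y y) x = -mlieBracket 𝓘(ℝ, E) X Y x := by
    have h := mlieBracket_const_smul_right (V := X) (c := (-1 : ℝ)) (mdiff_of_smooth hY x)
    have e : (-1 : ℝ) • Y = fun y ↦ -Y y := funext fun y ↦ neg_one_smul ℝ (Y y)
    rw [e] at h
    exact h.trans (neg_one_smul ℝ _)
  simp only [curvature, hb, map_neg]
  rw [covariant_neg D h]
  abel

/-- The curvature of the complex linear extension of a connection, in terms of real and imaginary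
parts. -/
theorem complexify_curvature
    (hD : ∀ X Y : Π x : M, TangentSpace 𝓘(ℝ, E) x, CMDiff ∞ (T% X) → CMDiff ∞ (T% Y) →
      CMDiff ∞ (T% fun x ↦ D Y x (X x)))
    {s Z W : Π x : M, CTan E x} (hs : IsSmooth s) (hZ : IsSmooth Z) (hW : IsSmooth W) (x : M)
    (h1 : ∀ X : Π x : M, TangentSpace 𝓘(ℝ, E) x, CMDiff ∞ (T% X) →
      curvature D (fun y ↦ imC y (Z y)) (fun y ↦ imC y (W y)) X x
        = curvature D (fun y ↦ reC y (Z y)) (fun y ↦ reC y (W y)) X x)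
    (h2 : ∀ X : Π x : M, TangentSpace 𝓘(ℝ, E) x, CMDiff ∞ (T% X) →
      curvature D (fun y ↦ imC y (Z y)) (fun y ↦ reC y (W y)) X x
        = -curvature D (fun y ↦ reC y (Z y)) (fun y ↦ imC y (W y)) X x) :
    complexify D (fun y ↦ complexify D s y (W y)) x (Z x)
      - complexify D (fun y ↦ complexify D s y (Z y)) x (W x)
      - complexify D s x (cBracket Z W x) = 0 := by
  have hr {W : Π x : M, CTan E x} (hW : IsSmooth W) (v) :
      D (fun y ↦ reC y (complexify D s y (W y))) x v
        = D (fun y ↦ D (fun y ↦ reC y (s y)) y (reC y (W y))) x v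
          - D (fun y ↦ D (fun y ↦ imC y (s y)) y (imC y (W y))) x v := by
    simp only [reC_complexify]
    exact covariant_sub D (hD _ _ hW.1 hs.1) (hD _ _ hW.2 hs.2) x v
  have hi {W : Π x : M, CTan E x} (hW : IsSmooth W) (v) :
      D (fun y ↦ imC y (complexify D s y (W y))) x v
        = D (fun y ↦ D (fun y ↦ reC y (s y)) y (imC y (W y))) x v
          + D (fun y ↦ D (fun y ↦ imC y (s y)) y (reC y (W y))) x v := by
    simp only [imC_complexify]
    exact covariant_add D (hD _ _ hW.2 hs.1) (hD _ _ hW.1 hs.2) x v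
  -- For Z = a + ib and W = c + id, bilinearity gives R(Z,W) = R(a,c) - R(b,d) + i(R(a,d) + R(b,c)).
  -- The hypotheses `h1` and `h2` annihilate both parts, on Re s and on Im s.
  have a1 := h1 _ hs.1
  have a2 := h1 _ hs.2
  have b1 := h2 _ hs.1
  have b2 := h2 _ hs.2
  simp only [curvature] at a1 a2 b1 b2
  apply ext_reC_imC
  · rw [map_sub, map_sub, map_zero, reC_complexify, reC_complexify, reC_complexify, hr hW, hi hW,
      hr hZ, hi hZ, cBracket, reC_mkC, imC_mkC, map_sub, map_add]
    linear_combination (norm := module) -a1 - b2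
  · rw [map_sub, map_sub, map_zero, imC_complexify, imC_complexify, imC_complexify, hr hW, hi hW,
      hr hZ, hi hZ, cBracket, reC_mkC, imC_mkC, map_sub, map_add]
    linear_combination (norm := module) -a2 + b1

end Complexify

/-- Sections of T^{0,1} are a + iJa. The Nijenhuis identity for the real parts of Z and W is
precisely the eigenvector equation for their bracket. -/
theorem HermitianStructure.cBracket_mem_T01 {g : Metric E M} (S : HermitianStructure g)
    {Z W : Π x : M, CTan E x} (hZ : IsSection (T01 S.J) Z) (hW : IsSection (T01 S.J) W) (x : M) :
    cBracket Z W x ∈ T01 S.J x := by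
  have h := S.integrable _ _ hZ.1.1 hW.1.1 x
  have eZ : (fun y ↦ S.J y (reC y (Z y))) = fun y ↦ imC y (Z y) :=
    funext fun y ↦ (mem_T01_iff.1 (hZ.2 y)).1
  have eW : (fun y ↦ S.J y (reC y (W y))) = fun y ↦ imC y (W y) :=
    funext fun y ↦ (mem_T01_iff.1 (hW.2 y)).1
  rw [eZ, eW] at h
  have h' : mlieBracket 𝓘(ℝ, E) (fun y ↦ reC y (Z y)) (fun y ↦ reC y (W y)) x
      - mlieBracket 𝓘(ℝ, E) (fun y ↦ imC y (Z y)) (fun y ↦ imC y (W y)) x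
      = -S.J x (mlieBracket 𝓘(ℝ, E) (fun y ↦ reC y (Z y)) (fun y ↦ imC y (W y)) x
        + mlieBracket 𝓘(ℝ, E) (fun y ↦ imC y (Z y)) (fun y ↦ reC y (W y)) x) := by
    rw [map_add]
    linear_combination (norm := module) -h
  rw [mem_T01_iff, cBracket, reC_mkC, imC_mkC, h', map_neg, S.sq, neg_neg, neg_neg]
  exact ⟨rfl, rfl⟩

/-! ### The connection ∇⁺ on T^{1,0}₊ over (M, J₋). -/

namespace GKStructure

variable [T2Space M] (𝒢 : GKStructure E M)

/-- A connection that commutes with J₊ preserves its eigenbundles. -/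
theorem complexify_nablaPlus_mem {s : Π x : M, CTan E x} (hs : IsSection (T10 𝒢.Jp) s) (x : M)
    (w : CTan E x) : complexify 𝒢.nablaPlus s x w ∈ T10 𝒢.Jp x := by
  have e1 (v) := 𝒢.nablaPlus_J hs.1.1 x v
  have e2 (v) := 𝒢.nablaPlus_J hs.1.2 x v
  have h1 : (fun y ↦ 𝒢.Jp y (reC y (s y))) = fun y ↦ -imC y (s y) :=
    funext fun y ↦ (mem_T10_iff.1 (hs.2 y)).1
  have h2 : (fun y ↦ 𝒢.Jp y (imC y (s y))) = fun y ↦ reC y (s y) :=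
    funext fun y ↦ (mem_T10_iff.1 (hs.2 y)).2
  rw [h1] at e1
  rw [h2] at e2
  simp only [covariant_neg 𝒢.nablaPlus hs.1.2] at e1
  rw [mem_T10_iff, reC_complexify, imC_complexify, map_sub, map_add, ← e1, ← e1, ← e2, ← e2]
  constructor <;> abel

theorem smooth_complexify_nablaPlus {s Z : Π x : M, CTan E x} (hs : IsSmooth s) (hZ : IsSmooth Z) :
    IsSmooth fun x ↦ complexify 𝒢.nablaPlus s x (Z x) :=
  IsSmooth.mk (ContMDiff.sub_section (𝒢.smooth_nablaPlus hZ.1 hs.1) (𝒢.smooth_nablaPlus hZ.2 hs.2))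
    (ContMDiff.add_section (𝒢.smooth_nablaPlus hZ.2 hs.1) (𝒢.smooth_nablaPlus hZ.1 hs.2))
    (fun _ ↦ reC_complexify _ _ _ _) (fun _ ↦ imC_complexify _ _ _ _)

theorem isConnection_nablaPlus : IsConnection (T10 𝒢.Jp) (complexify 𝒢.nablaPlus) where
  mem _ hs := 𝒢.complexify_nablaPlus_mem hs
  smooth _ hs _ hZ := 𝒢.smooth_complexify_nablaPlus hs.1 hZ
  add _ _ hs ht := complexify_add _ hs.1 ht.1
  leibniz _ _ hf hs := complexify_smul _ hf hs.1

theorem _root_.GK.HermitianStructure.smooth_proj01 {g : Metric E M} (S : HermitianStructure g)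
    {Z : Π x : M, CTan E x} (hZ : IsSmooth Z) : IsSmooth fun x ↦ proj01 S.J x (Z x) :=
  IsSmooth.mk
    (ContMDiff.const_smul_section (a := (1 / 2 : ℝ)) (ContMDiff.sub_section hZ.1 (S.smooth_apply hZ.2)))
    (ContMDiff.const_smul_section (a := (1 / 2 : ℝ)) (ContMDiff.add_section hZ.2 (S.smooth_apply hZ.1)))
    (fun _ ↦ reC_proj01 _) (fun _ ↦ imC_proj01 _)

theorem dbarPart_apply_of_mem_T01 {J : Π x : M, TangentSpace 𝓘(ℝ, E) x →L[ℝ] TangentSpace 𝓘(ℝ, E) x}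
    (D : (Π x : M, CTan E x) → Π x : M, CTan E x →ₗ[ℂ] CTan E x) (s : Π x : M, CTan E x) {x : M}
    {w : CTan E x} (hw : w ∈ T01 J x) : dbarPart J D s x w = D s x w :=
  congrArg (D s x) (proj01_of_mem_T01 hw)

/-- On T^{0,1}, to which the bracket also belongs, δ is the full connection, so δ² is the
complexified curvature on two (0,1)-vectors. It vanishes because R⁺ has type (1,1) for J₋. -/
theorem dbarPart_nablaPlus_flat (s Z W : Π x : M, CTan E x) (hs : IsSmooth s)
    (hZ : IsSection (T01 𝒢.Jm) Z) (hW : IsSection (T01 𝒢.Jm) W) (x : M) :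
    let δ := dbarPart 𝒢.Jm (complexify 𝒢.nablaPlus)
    δ (fun y ↦ δ s y (W y)) x (Z x) - δ (fun y ↦ δ s y (Z y)) x (W x) - δ s x (cBracket Z W x)
      = 0 := by
  intro δ
  have d (t : Π x : M, CTan E x) (y : M) (w : CTan E y) (hw : w ∈ T01 𝒢.Jm y) :
      δ t y w = complexify 𝒢.nablaPlus t y w := dbarPart_apply_of_mem_T01 _ t hw
  rw [d _ x _ (hZ.2 x), d _ x _ (hW.2 x), d _ x _ (𝒢.minus.cBracket_mem_T01 hZ hW x),
    funext fun y ↦ d s y _ (hZ.2 y), funext fun y ↦ d s y _ (hW.2 y)]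
  have eZ : (fun y ↦ 𝒢.Jm y (reC y (Z y))) = fun y ↦ imC y (Z y) :=
    funext fun y ↦ (mem_T01_iff.1 (hZ.2 y)).1
  have eW : (fun y ↦ 𝒢.Jm y (reC y (W y))) = fun y ↦ imC y (W y) :=
    funext fun y ↦ (mem_T01_iff.1 (hW.2 y)).1
  have eW' : (fun y ↦ 𝒢.Jm y (imC y (W y))) = fun y ↦ -reC y (W y) :=
    funext fun y ↦ (mem_T01_iff.1 (hW.2 y)).2
  refine complexify_curvature _ (fun X Y hX hY ↦ 𝒢.smooth_nablaPlus hX hY) hs hZ.1 hW.1 x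
    (fun X hX ↦ ?_) (fun X hX ↦ ?_)
  -- With Z = a + iJ₋a and W = c + iJ₋c, this is R(J₋a, J₋c) = R(a,c).
  · have h := 𝒢.curvature_nablaPlus_J hZ.1.1 hW.1.1 hX x
    rw [eZ, eW] at h
    exact h
  -- The same invariance for the pair (a, J₋c), with J₋² = -1, gives R(J₋a, c) = -R(a, J₋c).
  · have h := 𝒢.curvature_nablaPlus_J hZ.1.1 hW.1.2 hX x
    rw [eZ, eW', curvature_neg_right _ hW.1.1 x (𝒢.smooth_nablaPlus hW.1.1 hX)] at h
    rw [← h, neg_neg]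

theorem isHolomorphicStructure_nablaPlus :
    IsHolomorphicStructure 𝒢.Jm (T10 𝒢.Jp) (dbarPart 𝒢.Jm (complexify 𝒢.nablaPlus)) where
  mem _ hs x _ := 𝒢.complexify_nablaPlus_mem hs x _
  type01 s _ x _ hw :=
    (congrArg (complexify 𝒢.nablaPlus s x) (proj01_of_mem_T10 hw)).trans (map_zero _)
  smooth _ hs _ hZ := 𝒢.smooth_complexify_nablaPlus hs.1 (𝒢.minus.smooth_proj01 hZ)
  add s t hs ht x := by
    rw [dbarPart, complexify_add _ hs.1 ht.1, LinearMap.add_comp]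
    rfl
  leibniz _ _ hf hs _ _ := complexify_smul _ hf hs.1 _ _
  flat s hs Z W hZ hW x := 𝒢.dbarPart_nablaPlus_flat s Z W hs.1 hZ hW x

theorem isChernConnection_nablaPlus :
    IsChernConnection 𝒢.Jm (T10 𝒢.Jp) (hermForm 𝒢.g) (dbarPart 𝒢.Jm (complexify 𝒢.nablaPlus))
      (complexify 𝒢.nablaPlus) where
  isConnection := 𝒢.isConnection_nablaPlus
  hermitian s t hs ht x v := by
    have g1 {X Y : Π x : M, TangentSpace 𝓘(ℝ, E) x} (hX : CMDiff ∞ (T% X)) (hY : CMDiff ∞ (T% Y)) :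
      MDiffAt (fun y ↦ 𝒢.g.inner y (X y) (Y y)) x :=
        (𝒢.g.smooth' hX hY).mdifferentiable (by simp) x
    have hm := smooth_hermForm 𝒢.g hs.1 ht.1
    apply Complex.ext
    · rw [re_mvfderiv hm]
      change d% (fun y ↦ 𝒢.g.inner y (reC y (s y)) (reC y (t y))
        + 𝒢.g.inner y (imC y (s y)) (imC y (t y))) x v = _
      rw [mvfderiv_fun_add (g1 hs.1.1 ht.1.1) (g1 hs.1.2 ht.1.2), add_apply,
        𝒢.nablaPlus_metric hs.1.1 ht.1.1, 𝒢.nablaPlus_metric hs.1.2 ht.1.2]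
      simp only [hermForm, Complex.add_re, reC_complexify, imC_complexify, reC_mkC, imC_mkC, map_zero,
        sub_zero, zero_add]
      ring
    · rw [im_mvfderiv hm]
      change d% (fun y ↦ 𝒢.g.inner y (imC y (s y)) (reC y (t y))
        - 𝒢.g.inner y (reC y (s y)) (imC y (t y))) x v = _
      rw [mvfderiv_fun_sub (g1 hs.1.2 ht.1.1) (g1 hs.1.1 ht.1.2), sub_apply,
        𝒢.nablaPlus_metric hs.1.2 ht.1.1, 𝒢.nablaPlus_metric hs.1.1 ht.1.2]
      simp only [hermForm, Complex.add_im, reC_complexify, imC_complexify, reC_mkC, imC_mkC, map_zero,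
        sub_zero, zero_add]
      ring
  dbar_eq _ _ _ := rfl

end GKStructure

end Chern

/-! ### Uniqueness of the Chern connection -/

section Uniqueness

variable {E : Type*} [NormedAddCommGroup E] [NormedSpace ℝ E]
  {M : Type*} [TopologicalSpace M] [ChartedSpace E M] [IsManifold 𝓘(ℝ, E) ∞ M]
  [FiniteDimensional ℝ E]

theorem HermitianStructure.sub_proj01_mem_T10 {g : Metric E M} (S : HermitianStructure g) {x : M}
    (w : CTan E x) : w - proj01 S.J x w ∈ T10 S.J x := by
  rw [mem_T10_iff]
  simp only [map_sub, reC_proj01, imC_proj01, map_smul, map_add, S.sq]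
  constructor <;> module

theorem hermForm_sub_left (g : Metric E M) (x : M) (s t u : CTan E x) :
    hermForm g x (s - t) u = hermForm g x s u - hermForm g x t u := by
  apply Complex.ext <;> simp [hermForm] <;> ring

theorem hermForm_sub_right (g : Metric E M) (x : M) (s t u : CTan E x) :
    hermForm g x u (s - t) = hermForm g x u s - hermForm g x u t := by
  apply Complex.ext <;> simp [hermForm] <;> ring

theorem hermForm_zero_right (g : Metric E M) (x : M) (u : CTan E x) : hermForm g x u 0 = 0 := by
  apply Complex.ext <;> simp [hermForm]

theorem hermForm_sub_I_smul_right (g : Metric E M) (x : M) (s t u : CTan E x) :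
    hermForm g x u (s - Complex.I • t) = hermForm g x u s + Complex.I * hermForm g x u t := by
  apply Complex.ext <;> simp [hermForm, reC_I_smul, imC_I_smul] <;> ring

theorem exists_isSmooth_apply_eq [T2Space M] (x : M) (w : CTan E x) :
    ∃ Z : Π x : M, CTan E x, IsSmooth Z ∧ Z x = w := by
  obtain ⟨X, hX, hXx⟩ := exists_smooth_apply_eq x (reC x w)
  obtain ⟨Y, hY, hYx⟩ := exists_smooth_apply_eq x (imC x w)
  refine ⟨fun y ↦ mkC (X y) (Y y), IsSmooth.mk hX hY (fun _ ↦ reC_mkC _ _) fun _ ↦ imC_mkC _ _, ?_⟩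
  exact (congrArg₂ mkC hXx hYx).trans (mkC_reC_imC w)

theorem IsSection.sub {V : Π x : M, Submodule ℂ (CTan E x)} {s t : Π x : M, CTan E x}
    (hs : IsSection V s) (ht : IsSection V t) : IsSection V fun x ↦ s x - t x :=
  ⟨IsSmooth.mk (ContMDiff.sub_section hs.1.1 ht.1.1) (ContMDiff.sub_section hs.1.2 ht.1.2)
    (fun _ ↦ map_sub _ _ _) (fun _ ↦ map_sub _ _ _), fun x ↦ Submodule.sub_mem _ (hs.2 x) (ht.2 x)⟩

theorem IsConnection.isSection {V : Π x : M, Submodule ℂ (CTan E x)}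
    {D : (Π x : M, CTan E x) → Π x : M, CTan E x →ₗ[ℂ] CTan E x} (hD : IsConnection V D)
    {s Z : Π x : M, CTan E x} (hs : IsSection V s) (hZ : IsSmooth Z) :
    IsSection V fun x ↦ D s x (Z x) :=
  ⟨hD.smooth s hs Z hZ, fun x ↦ hD.mem s hs x _⟩

theorem mkC_eq_add {x : M} (v w : TangentSpace 𝓘(ℝ, E) x) :
    mkC v w = mkC v 0 + Complex.I • mkC w 0 := by
  simp [mkC, TensorProduct.smul_tmul']

theorem mkC_neg_eq_sub {x : M} (v w : TangentSpace 𝓘(ℝ, E) x) :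
    mkC v (-w) = mkC v 0 - Complex.I • mkC w 0 := by
  simp [mkC, TensorProduct.smul_tmul', TensorProduct.tmul_neg, sub_eq_add_neg]

/-- A Chern connection is determined by the Hermitian metric and the holomorphic structure. -/
theorem IsChernConnection.unique [T2Space M] {g : Metric E M} (S : HermitianStructure g)
    {V : Π x : M, Submodule ℂ (CTan E x)}
    {δ D D' : (Π x : M, CTan E x) → Π x : M, CTan E x →ₗ[ℂ] CTan E x}
    (hD : IsChernConnection S.J V (hermForm g) δ D) (hD' : IsChernConnection S.J V (hermForm g) δ D')
    {s : Π x : M, CTan E x} (hs : IsSection V s) (x : M) : D s x = D' s x := by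
  -- Both connections have (0,1)-part δ, so their difference θ = D - D' kills T^{0,1}.
  have h01 {t : Π x : M, CTan E x} (ht : IsSection V t) (w : CTan E x) (hw : w ∈ T01 S.J x) :
      (D t x - D' t x) w = 0 := by
    have h := congrArg (fun L ↦ L w) ((hD.dbar_eq t ht x).trans (hD'.dbar_eq t ht x).symm)
    rw [LinearMap.sub_apply, sub_eq_zero]
    simpa only [dbarPart, LinearMap.comp_apply, proj01_of_mem_T01 hw] using h
  -- Both preserve h, so θ is skew-Hermitian along real vectors; `hcomplex` extends this to complex
  -- w, with the conjugate of w in the second term.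
  have hreal {t : Π x : M, CTan E x} (ht : IsSection V t) (v : TangentSpace 𝓘(ℝ, E) x) :
      hermForm g x ((D s x - D' s x) (mkC v 0)) (t x)
        + hermForm g x (s x) ((D t x - D' t x) (mkC v 0)) = 0 := by
    have h := (hD.hermitian s t hs ht x v).symm.trans (hD'.hermitian s t hs ht x v)
    rw [LinearMap.sub_apply, LinearMap.sub_apply, hermForm_sub_left, hermForm_sub_right]
    linear_combination h
  have hcomplex {t : Π x : M, CTan E x} (ht : IsSection V t) (w : CTan E x) :
      hermForm g x ((D s x - D' s x) w) (t x)
        + hermForm g x (s x) ((D t x - D' t x) (conjC w)) = 0 := by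
    have e : hermForm g x ((D s x - D' s x) w) (t x)
        = hermForm g x ((D s x - D' s x) (mkC (reC x w) 0)) (t x)
          + Complex.I * hermForm g x ((D s x - D' s x) (mkC (imC x w) 0)) (t x) := by
      conv_lhs => rw [← mkC_reC_imC w, mkC_eq_add, map_add, map_smul]
      rw [hermForm_add_left, hermForm_smul_left]
    rw [e, conjC, mkC_neg_eq_sub, map_sub (D t x - D' t x), map_smul, hermForm_sub_I_smul_right]
    linear_combination hreal ht (reC x w) + Complex.I * hreal ht (imC x w)
  have h10 (w : CTan E x) (hw : w ∈ T10 S.J x) : (D s x - D' s x) w = 0 := by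
    -- The test section t = D_Z s - D'_Z s has value θ_w s at x. As w̄ is of type (0,1), θ_w̄ t
    -- vanishes and h(θ_w s, θ_w s) = 0. Linearity of θ over functions in the section is not needed.
    obtain ⟨Z, hZ, rfl⟩ := exists_isSmooth_apply_eq x w
    have ht := (hD.isConnection.isSection hs hZ).sub (hD'.isConnection.isSection hs hZ)
    have h := hcomplex ht (Z x)
    rw [h01 ht _ (conjC_mem_T01 hw), hermForm_zero_right, add_zero] at h
    by_contra hne
    exact (hermForm_self_pos g x hne).ne' (congrArg Complex.re h)
  refine LinearMap.ext fun w ↦ ?_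
  have hw01 : proj01 S.J x w ∈ T01 S.J x := by
    rw [mem_T01_iff, reC_proj01, imC_proj01]
    simp only [map_sub, map_smul, map_add, S.sq]
    constructor <;> module
  have h1 := h01 hs _ hw01
  have h2 := h10 _ (S.sub_proj01_mem_T10 w)
  rw [map_sub (D s x - D' s x), h1, sub_zero, LinearMap.sub_apply, sub_eq_zero] at h2
  exact h2

end Uniqueness

end GK

end

/-- On a generalized Kähler manifold, the curvatures of the Bismut connections `∇^±` satisfy
`R⁺(J₋X, J₋Y, Z, W) = R⁺(X, Y, Z, W)` and `R⁻(J₊X, J₊Y, Z, W) = R⁻(X, Y, Z, W)`. The `(0,1)`-part of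
`∇^±` with respect to `J_∓` is a `J_∓`-holomorphic structure on `T^{1,0}_±`, and `∇^±` is the unique
Chern connection of this structure and of the Hermitian metric `h_±` induced from `g`. -/
theorem lemma3p1 {E : Type*} [NormedAddCommGroup E] [NormedSpace ℝ E] [FiniteDimensional ℝ E]
    {M : Type*} [TopologicalSpace M] [T2Space M] [SecondCountableTopology M] [ChartedSpace E M]
    [IsManifold 𝓘(ℝ, E) ∞ M] (𝒢 : GK.GKStructure E M) :
    (∀ X Y Z W : Π x : M, TangentSpace 𝓘(ℝ, E) x,
      CMDiff ∞ (T% X) → CMDiff ∞ (T% Y) → CMDiff ∞ (T% Z) → CMDiff ∞ (T% W) → ∀ x : M,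
        GK.curvature4 𝒢.g 𝒢.nablaPlus (fun y ↦ 𝒢.Jm y (X y)) (fun y ↦ 𝒢.Jm y (Y y)) Z W x
            = GK.curvature4 𝒢.g 𝒢.nablaPlus X Y Z W x
        ∧ GK.curvature4 𝒢.g 𝒢.nablaMinus (fun y ↦ 𝒢.Jp y (X y)) (fun y ↦ 𝒢.Jp y (Y y)) Z W x
            = GK.curvature4 𝒢.g 𝒢.nablaMinus X Y Z W x)
    ∧ GK.IsHermitianMetric (GK.T10 𝒢.Jp) (GK.hermForm 𝒢.g)
    ∧ GK.IsHolomorphicStructure 𝒢.Jm (GK.T10 𝒢.Jp)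
        (GK.dbarPart 𝒢.Jm (GK.complexify 𝒢.nablaPlus))
    ∧ GK.IsChernConnection 𝒢.Jm (GK.T10 𝒢.Jp) (GK.hermForm 𝒢.g)
        (GK.dbarPart 𝒢.Jm (GK.complexify 𝒢.nablaPlus)) (GK.complexify 𝒢.nablaPlus)
    ∧ (∀ D, GK.IsChernConnection 𝒢.Jm (GK.T10 𝒢.Jp) (GK.hermForm 𝒢.g)
          (GK.dbarPart 𝒢.Jm (GK.complexify 𝒢.nablaPlus)) D →
        ∀ s, GK.IsSection (GK.T10 𝒢.Jp) s → ∀ x, D s x = GK.complexify 𝒢.nablaPlus s x)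
    ∧ GK.IsHermitianMetric (GK.T10 𝒢.Jm) (GK.hermForm 𝒢.g)
    ∧ GK.IsHolomorphicStructure 𝒢.Jp (GK.T10 𝒢.Jm)
        (GK.dbarPart 𝒢.Jp (GK.complexify 𝒢.nablaMinus))
    ∧ GK.IsChernConnection 𝒢.Jp (GK.T10 𝒢.Jm) (GK.hermForm 𝒢.g)
        (GK.dbarPart 𝒢.Jp (GK.complexify 𝒢.nablaMinus)) (GK.complexify 𝒢.nablaMinus)
    ∧ (∀ D, GK.IsChernConnection 𝒢.Jp (GK.T10 𝒢.Jm) (GK.hermForm 𝒢.g)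
          (GK.dbarPart 𝒢.Jp (GK.complexify 𝒢.nablaMinus)) D →
        ∀ s, GK.IsSection (GK.T10 𝒢.Jm) s → ∀ x, D s x = GK.complexify 𝒢.nablaMinus s x) := by
  -- The minus statements are the plus statements for the exchanged structure, whose ∇⁺ is ∇⁻ and
  -- whose metric is the same.
  have hm := 𝒢.swap.isHolomorphicStructure_nablaPlus
  have hc := 𝒢.swap.isChernConnection_nablaPlus
  rw [𝒢.swap_nablaPlus] at hm hc
  refine ⟨fun X Y Z W hX hY hZ _ x ↦ ⟨?_, ?_⟩, GK.isHermitianMetric_hermForm _ _,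
    𝒢.isHolomorphicStructure_nablaPlus, 𝒢.isChernConnection_nablaPlus,
    fun D hD s hs x ↦ hD.unique 𝒢.minus 𝒢.isChernConnection_nablaPlus hs x,
    GK.isHermitianMetric_hermForm _ _, hm, hc, fun D hD s hs x ↦ hD.unique 𝒢.plus hc hs x⟩
  · rw [GK.curvature4, 𝒢.curvature_nablaPlus_J hX hY hZ]
    rfl
  · have h := 𝒢.swap.curvature_nablaPlus_J hX hY hZ x
    rw [𝒢.swap_nablaPlus] at h
    exact congrArg (fun v ↦ 𝒢.g.inner x v (W x)) h
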